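/- Let $K$ be a compact Lie group with Lie algebra $\mathfrak k$ and let $G$ be its complexification, a complex reductive group (realised as an algebraic subgroup of $GL_N(\mathbf C)$ stable under conjugate transpose, with $K=G\cap U(N)$). Let $(X,L)$ be a smooth polarised variety: a compact complex manifold $X$ with a holomorphic line bundle $L$ and a Hermitian metric on $L$ whose Chern curvature is $-i\omega$, where $\omega$ is a Kähler form. Let $G$ act holomorphically on $X$, with a lift to a holomorphic action on $L$ that is linear on the fibres, such that $K$ preserves $\omega$. Let $\mu:X\to\mathfrak k^*$ be a moment map for the action of $K$, i.e. a smooth $K$-equivariant map with $d\langle\mu,\xi\rangle=\omega(\sigma(\xi),\cdot)$ for all $\xi\in\mathfrak k$, where $\sigma(\xi)$ is the vector field on $X$ induced by $\xi$, and assume that the action on $L$ is the one determined by $\mu$: the vector field on $L$ induced by $\xi\in\mathfrak k$ is $\tilde\sigma(\xi)+i\langle\mu,\xi\rangle t$, where $\tilde\sigma(\xi)$ is the horizontal lift of $\sigma(\xi)$ for the Chern connection and $t$ is the canonical (Euler) vertical vector field. Fix a $K$-invariant inner product on $\mathfrak k$, which identifies $\mathfrak k^*$ with $\mathfrak k$ and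 defines $\|\mu\|$. If $\xi\in\mathfrak k$ generates a subgroup fixing $y\in X$, let $F_y(\xi)\in\mathbf R$ be minus the weight of $\xi$ on $L_y$, i.e. $\exp(s\xi)$ acts on $L_y$ as multiplication by $e^{-isF_y(\xi)}$ for $s\in\mathbf R$. Let $x\in X$, let $T\subset K$ be a torus fixing $x$ (for instance a maximal one), with Lie algebra $\mathfrak t$, and let $\chi\in\mathfrak t$ be the corresponding extremal vector field, i.e. the element with $F_x(\beta)=\langle\beta,\chi\rangle$ for all $\beta\in\mathfrak t$. Let $\alpha\in\mathfrak k_T=\{\xi\in\mathfrak k : [\xi,\beta]=0\text{ for all }\beta\in\mathfrak t\}$ generate a one-parameter subgroup (i.e. $\exp(\tau\alpha)=1$ for some $\tau>0$), and let $x_0=\lim_{t\to-\infty}\exp(it\alpha)\cdot x$. If the modified weight $F_{x_0,\chi}(\alpha):=F_{x_0}(\alpha)-\langle\alpha,\chi\rangle$ is negative, then $$\inf_{g\in G}\|\mu(g\cdot x)\|^2\ \ge\ \|\chi\|^2+\frac{F_{x_0,\chi}(\alpha)^2}{\|\alpha\|^2}.$$ -/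

import Mathlib

open scoped Manifold ContDiff Matrix Topology

namespace KempfNess

open Bundle Filter

/-! ### Complex reductive groups, their maximal compact subgroups, and exponentials -/

section Exponential

/-- If `γ` is differentiable at `0` with `γ 0 = 1` and derivative `C`, then
`γ (1 / n) ^ n → exp C`. -/
theorem tendsto_pow_exp {𝔸 : Type*} [NormedRing 𝔸] [NormOneClass 𝔸] [NormedAlgebra ℝ 𝔸]
    [CompleteSpace 𝔸] (γ : ℝ → 𝔸) (C : 𝔸) (h0 : γ 0 = 1) (hγ : HasDerivAt γ C 0) :
    Tendsto (fun n : ℕ => γ (1 / ((n : ℝ) + 1)) ^ (n + 1)) atTop (𝓝 (NormedSpace.exp C)) := by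
  have hpow : ∀ (X Y : 𝔸) (M : ℝ), 1 ≤ M → ‖X‖ ≤ M → ‖Y‖ ≤ M → ∀ n : ℕ,
      ‖X ^ n - Y ^ n‖ ≤ n * ‖X - Y‖ * M ^ n := by
    intro X Y M hM hX hY n
    induction n with
    | zero => simp
    | succ n ih =>
      have e : X ^ (n + 1) - Y ^ (n + 1) = X ^ n * (X - Y) + (X ^ n - Y ^ n) * Y := by
        rw [pow_succ, pow_succ]; noncomm_ring
      have h1 : ‖X ^ n * (X - Y)‖ ≤ M ^ n * ‖X - Y‖ :=
        (norm_mul_le _ _).trans (by gcongr; exact (norm_pow_le X n).trans (by gcongr))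
      have h2 : ‖(X ^ n - Y ^ n) * Y‖ ≤ n * ‖X - Y‖ * M ^ n * M :=
        (norm_mul_le _ _).trans (by gcongr)
      have h3 : M ^ n * ‖X - Y‖ ≤ ‖X - Y‖ * M ^ (n + 1) := by
        rw [mul_comm, pow_succ]
        gcongr
        exact le_mul_of_one_le_right (by positivity) hM
      calc ‖X ^ (n + 1) - Y ^ (n + 1)‖ ≤ ‖X ^ n * (X - Y)‖ + ‖(X ^ n - Y ^ n) * Y‖ := by
            rw [e]; exact norm_add_le _ _
        _ ≤ ‖X - Y‖ * M ^ (n + 1) + n * ‖X - Y‖ * M ^ n * M := by linarith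
        _ = ((n + 1 : ℕ) : ℝ) * ‖X - Y‖ * M ^ (n + 1) := by push_cast; ring
  set ε : ℝ → 𝔸 := fun t => NormedSpace.exp (t • C) with hε
  have hεd : HasDerivAt ε C 0 := by
    simpa using hasDerivAt_exp_smul_const (𝕂 := ℝ) C (0 : ℝ)
  have hε0 : ε 0 = 1 := by simp [hε]
  have hseq : Tendsto (fun n : ℕ => 1 / ((n : ℝ) + 1)) atTop (𝓝 0) :=
    tendsto_one_div_add_atTop_nhds_zero_nat
  have hlip : ∀ φ : ℝ → 𝔸, φ 0 = 1 → HasDerivAt φ C 0 →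
      ∀ᶠ t in 𝓝 (0 : ℝ), ‖φ t‖ ≤ 1 + (‖C‖ + 1) * |t| := by
    intro φ hφ0 hφ
    have := (hasDerivAt_iff_isLittleO.1 hφ).bound (c := 1) one_pos
    filter_upwards [this] with t ht
    simp only [sub_zero, hφ0, one_mul, Real.norm_eq_abs] at ht
    have e : φ t = 1 + t • C + (φ t - 1 - t • C) := by abel
    calc ‖φ t‖ ≤ ‖(1 : 𝔸)‖ + ‖t • C‖ + ‖φ t - 1 - t • C‖ := by
          conv_lhs => rw [e]
          exact norm_add₃_le
      _ ≤ 1 + |t| * ‖C‖ + |t| := by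
          rw [norm_one, norm_smul, Real.norm_eq_abs]; gcongr
      _ = _ := by ring
  have hdiff : (fun t : ℝ => γ t - ε t) =o[𝓝 0] fun t : ℝ => t := by
    have := hasDerivAt_iff_isLittleO.1 (hγ.sub hεd)
    simpa [h0, hε0] using this
  have hεpow : ∀ n : ℕ, ε (1 / ((n : ℝ) + 1)) ^ (n + 1) = NormedSpace.exp C := by
    intro n
    have : ((n + 1 : ℕ) : ℕ) • ((1 / ((n : ℝ) + 1)) • C) = C := by
      rw [← Nat.cast_smul_eq_nsmul ℝ, smul_smul]
      have : ((n : ℝ) + 1) ≠ 0 := by positivity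
      push_cast
      rw [mul_one_div_cancel this, one_smul]
    let _ : NormedAlgebra ℚ 𝔸 := NormedAlgebra.restrictScalars ℚ ℝ 𝔸
    have h := NormedSpace.exp_nsmul (n + 1) ((1 / ((n : ℝ) + 1)) • C)
    rw [this] at h
    exact h.symm
  rw [tendsto_iff_norm_sub_tendsto_zero]
  have hmain : Tendsto (fun n : ℕ => ‖γ (1 / ((n : ℝ) + 1)) - ε (1 / ((n : ℝ) + 1))‖ /
      ‖1 / ((n : ℝ) + 1)‖ * Real.exp (‖C‖ + 1)) atTop (𝓝 0) := by
    have := (hdiff.comp_tendsto hseq).norm_norm.tendsto_div_nhds_zero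
    simpa using this.mul_const (Real.exp (‖C‖ + 1))
  refine squeeze_zero' (Eventually.of_forall fun _ => norm_nonneg _) ?_ hmain
  filter_upwards [hseq.eventually (hlip γ h0 hγ), hseq.eventually (hlip ε hε0 hεd)] with n h1 h2
  have hn : (0 : ℝ) < (n : ℝ) + 1 := by positivity
  rw [← hεpow n]
  have hM : (1 : ℝ) ≤ 1 + (‖C‖ + 1) * |1 / ((n : ℝ) + 1)| := by
    have : 0 ≤ (‖C‖ + 1) * |1 / ((n : ℝ) + 1)| := by positivity
    linarith
  refine (hpow _ _ _ hM h1 h2 (n + 1)).trans ?_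
  have hE : (1 + (‖C‖ + 1) * |1 / ((n : ℝ) + 1)|) ^ (n + 1) ≤ Real.exp (‖C‖ + 1) := by
    have h3 : 1 + (‖C‖ + 1) * |1 / ((n : ℝ) + 1)| ≤ Real.exp ((‖C‖ + 1) / (n + 1)) := by
      rw [abs_of_pos (by positivity), mul_one_div, add_comm]
      exact Real.add_one_le_exp _
    calc _ ≤ Real.exp ((‖C‖ + 1) / (n + 1)) ^ (n + 1) := by gcongr
      _ = _ := by
        rw [← Real.exp_nat_mul]
        congr 1
        push_cast
        field_simp
  rw [Real.norm_eq_abs, abs_of_pos (show (0 : ℝ) < 1 / ((n : ℝ) + 1) by positivity), div_div_eq_mul_div,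
    div_one, mul_comm ‖_‖]
  rw [abs_of_pos (show (0 : ℝ) < 1 / ((n : ℝ) + 1) by positivity)] at hE
  push_cast
  gcongr

theorem exp_add_mem_of_banach {𝔸 : Type*} [NormedRing 𝔸] [NormOneClass 𝔸] [NormedAlgebra ℝ 𝔸]
    [CompleteSpace 𝔸] (S : Submonoid 𝔸) (hS : IsClosed (S : Set 𝔸)) {A B : 𝔸}
    (hA : ∀ t : ℝ, NormedSpace.exp (t • A) ∈ S) (hB : ∀ t : ℝ, NormedSpace.exp (t • B) ∈ S) :
    NormedSpace.exp (A + B) ∈ S := by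
  have hd : HasDerivAt (fun t : ℝ => NormedSpace.exp (t • A) * NormedSpace.exp (t • B))
      (A + B) 0 := by
    have h1 := hasDerivAt_exp_smul_const (𝕂 := ℝ) A (0 : ℝ)
    have h2 := hasDerivAt_exp_smul_const (𝕂 := ℝ) B (0 : ℝ)
    have h3 := h1.mul h2
    simp only [zero_smul, NormedSpace.exp_zero, one_mul, mul_one] at h3
    exact h3
  have := tendsto_pow_exp (fun t : ℝ => NormedSpace.exp (t • A) * NormedSpace.exp (t • B))
    (A + B) (by simp) hd
  exact hS.mem_of_tendsto this
    (Eventually.of_forall fun n => S.pow_mem (S.mul_mem (hA _) (hB _)) _)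

theorem differentiable_exp_of_banach {𝔸 : Type*} [NormedRing 𝔸] [NormedAlgebra ℂ 𝔸]
    [CompleteSpace 𝔸] (A : 𝔸) (l : 𝔸 →ₗ[ℂ] ℂ) (hl : Continuous l) :
    Differentiable ℂ fun w : ℂ => l (NormedSpace.exp (w • A)) :=
  (⟨l, hl⟩ : 𝔸 →L[ℂ] ℂ).differentiable.comp (differentiable_exp_smul_const ℂ A)

/-- The matrix exponential as an invertible matrix. -/
noncomputable def expGL {N : ℕ} (A : Matrix (Fin N) (Fin N) ℂ) : GL (Fin N) ℂ where
  val := NormedSpace.exp A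
  inv := NormedSpace.exp (-A)
  val_inv := by
    rw [← Matrix.exp_add_of_commute A (-A) (Commute.neg_right (Commute.refl A))]; simp
  inv_val := by
    rw [← Matrix.exp_add_of_commute (-A) A (Commute.neg_left (Commute.refl A))]; simp

theorem expGL_conj {N : ℕ} (k : GL (Fin N) ℂ) (A : Matrix (Fin N) (Fin N) ℂ) :
    expGL ((k : Matrix (Fin N) (Fin N) ℂ) * A * ((k⁻¹ : GL (Fin N) ℂ) : Matrix _ _ ℂ)) =
      k * expGL A * k⁻¹ :=
  Units.ext (Matrix.exp_units_conj k A)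

/-- A closed multiplicative set of matrices containing `exp (t A)` and `exp (t B)` for all real `t`
contains `exp (A + B)`. -/
theorem exp_add_mem {N : ℕ} (S : Submonoid (Matrix (Fin N) (Fin N) ℂ))
    (hS : IsClosed (S : Set (Matrix (Fin N) (Fin N) ℂ))) {A B : Matrix (Fin N) (Fin N) ℂ}
    (hA : ∀ t : ℝ, NormedSpace.exp (t • A) ∈ S) (hB : ∀ t : ℝ, NormedSpace.exp (t • B) ∈ S) :
    NormedSpace.exp (A + B) ∈ S := by
  rcases Nat.eq_zero_or_pos N with rfl | hN
  · have : NormedSpace.exp (A + B) = (1 : Matrix (Fin 0) (Fin 0) ℂ) := Subsingleton.elim _ _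
    rw [this]; exact S.one_mem
  have : Nonempty (Fin N) := ⟨⟨0, hN⟩⟩
  let _ : NormedRing (Matrix (Fin N) (Fin N) ℂ) := Matrix.linftyOpNormedRing
  let _ : NormedAlgebra ℝ (Matrix (Fin N) (Fin N) ℂ) := Matrix.linftyOpNormedAlgebra
  have : NormOneClass (Matrix (Fin N) (Fin N) ℂ) := Matrix.linfty_opNormOneClass
  exact exp_add_mem_of_banach S hS hA hB

/-- The matrix entries of `exp (w A)` are entire functions of `w`. -/
theorem differentiable_exp_entry {N : ℕ} (A : Matrix (Fin N) (Fin N) ℂ) (i j : Fin N) :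
    Differentiable ℂ fun w : ℂ => (NormedSpace.exp (w • A)) i j := by
  let _ : NormedRing (Matrix (Fin N) (Fin N) ℂ) := Matrix.linftyOpNormedRing
  let _ : NormedAlgebra ℂ (Matrix (Fin N) (Fin N) ℂ) := Matrix.linftyOpNormedAlgebra
  exact differentiable_exp_of_banach A
    { toFun := fun M => M i j, map_add' := fun _ _ => rfl, map_smul' := fun _ _ => rfl }
    (continuous_id.matrix_elem i j)

end Exponential

/-- A complex reductive group, realised in the standard way as a subgroup of `GL_N(ℂ)` that is cut
out by polynomial equations in the matrix entries and is stable under conjugate transpose. Every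
complex reductive group, with any prescribed maximal compact subgroup, is isomorphic to one of these
with maximal compact subgroup `G ∩ U(N)`, and all of these are reductive. -/
structure ComplexReductiveGroup (N : ℕ) where
  /-- the underlying group of matrices -/
  grp : Subgroup (GL (Fin N) ℂ)
  algebraic : ∃ S : Set (MvPolynomial (Fin N × Fin N) ℂ), ∀ g : GL (Fin N) ℂ,
    g ∈ grp ↔ ∀ P ∈ S,
      MvPolynomial.eval (fun ij => (g : Matrix (Fin N) (Fin N) ℂ) ij.1 ij.2) P = 0
  star_mem : ∀ g ∈ grp, star g ∈ grp

namespace ComplexReductiveGroup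

variable {N : ℕ} (G : ComplexReductiveGroup N)

/-- The maximal compact subgroup `K = G ∩ U(N)`. -/
def compactForm : Subgroup (GL (Fin N) ℂ) where
  carrier := {g | g ∈ G.grp ∧ (g : Matrix (Fin N) (Fin N) ℂ) ∈ Matrix.unitaryGroup (Fin N) ℂ}
  mul_mem' := fun ha hb => ⟨G.grp.mul_mem ha.1 hb.1, by
    rw [Units.val_mul]; exact Submonoid.mul_mem _ ha.2 hb.2⟩
  one_mem' := ⟨G.grp.one_mem, by rw [Units.val_one]; exact Submonoid.one_mem _⟩
  inv_mem' := by
    intro g hg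
    refine ⟨G.grp.inv_mem hg.1, ?_⟩
    have h1 : ((g⁻¹ : GL (Fin N) ℂ) : Matrix (Fin N) (Fin N) ℂ) =
        star (g : Matrix (Fin N) (Fin N) ℂ) :=
      Units.inv_eq_of_mul_eq_one_right (Unitary.mul_star_self_of_mem hg.2)
    rw [h1]
    exact Unitary.star_mem hg.2

theorem exp_add_mem_compactForm {A B : Matrix (Fin N) (Fin N) ℂ}
    (hA : ∀ t : ℝ, expGL (t • A) ∈ G.compactForm) (hB : ∀ t : ℝ, expGL (t • B) ∈ G.compactForm) :
    expGL (A + B) ∈ G.compactForm := by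
  obtain ⟨S, hS⟩ := G.algebraic
  let V : Set (Matrix (Fin N) (Fin N) ℂ) :=
    {M | M ∈ Matrix.unitaryGroup (Fin N) ℂ ∧
      ∀ P ∈ S, MvPolynomial.eval (fun ij => M ij.1 ij.2) P = 0}
  have hVG : ∀ M, M ∈ V ↔ ∃ g ∈ G.compactForm, (g : Matrix (Fin N) (Fin N) ℂ) = M := by
    intro M
    constructor
    · rintro ⟨h1, h2⟩
      exact ⟨⟨M, star M, Unitary.mul_star_self_of_mem h1, Unitary.star_mul_self_of_mem h1⟩,
        ⟨(hS _).2 h2, h1⟩, rfl⟩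
    · rintro ⟨g, hg, rfl⟩
      exact ⟨hg.2, (hS g).1 hg.1⟩
  let W : Submonoid (Matrix (Fin N) (Fin N) ℂ) :=
    { carrier := V
      mul_mem' := by
        intro a b ha hb
        obtain ⟨g, hg, rfl⟩ := (hVG _).1 ha
        obtain ⟨k, hk, rfl⟩ := (hVG _).1 hb
        exact (hVG _).2 ⟨g * k, G.compactForm.mul_mem hg hk, rfl⟩
      one_mem' := (hVG _).2 ⟨1, G.compactForm.one_mem, rfl⟩ }
  have hW : IsClosed (W : Set (Matrix (Fin N) (Fin N) ℂ)) := by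
    have e : (W : Set (Matrix (Fin N) (Fin N) ℂ)) =
        {M | M * star M = 1} ∩ ⋂ P ∈ S, {M | MvPolynomial.eval (fun ij => M ij.1 ij.2) P = 0} := by
      ext M
      change M ∈ V ↔ _
      simp [V, Matrix.mem_unitaryGroup_iff]
    rw [e]
    refine IsClosed.inter (isClosed_eq (by fun_prop) continuous_const) ?_
    refine isClosed_biInter fun P _ => isClosed_eq ?_ continuous_const
    exact (MvPolynomial.continuous_eval P).comp (by fun_prop)
  have := exp_add_mem W hW (A := A) (B := B) (fun t => (hVG _).2 ⟨_, hA t, rfl⟩)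
    (fun t => (hVG _).2 ⟨_, hB t, rfl⟩)
  obtain ⟨g, hg, hgM⟩ := (hVG _).1 this
  have : g = expGL (A + B) := Units.ext hgM
  exact this ▸ hg

/-- The Lie algebra `𝔨` of the compact group `K`. -/
def lieK : Submodule ℝ (Matrix (Fin N) (Fin N) ℂ) where
  carrier := {A | ∀ t : ℝ, expGL (t • A) ∈ G.compactForm}
  add_mem' := by
    intro A B hA hB t
    rw [smul_add]
    exact G.exp_add_mem_compactForm (fun s => by rw [smul_smul]; exact hA _)
      (fun s => by rw [smul_smul]; exact hB _)
  zero_mem' := by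
    intro t
    have : expGL (t • (0 : Matrix (Fin N) (Fin N) ℂ)) = 1 := Units.ext (by simp [expGL])
    rw [this]; exact G.compactForm.one_mem
  smul_mem' := by
    intro c A hA t
    rw [smul_smul]; exact hA _

/-- The complex one-parameter group generated by an element of `𝔨` stays in `G`. -/
theorem exp_mem_grp (z : ℂ) {A : Matrix (Fin N) (Fin N) ℂ} (hA : A ∈ G.lieK) :
    expGL (z • A) ∈ G.grp := by
  obtain ⟨S, hS⟩ := G.algebraic
  rw [hS]
  intro P hP
  have hdiff : ∀ Q : MvPolynomial (Fin N × Fin N) ℂ, Differentiable ℂ fun w : ℂ =>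
      MvPolynomial.eval
        (fun ij : Fin N × Fin N => (NormedSpace.exp (w • A)) ij.1 ij.2) Q := by
    intro Q
    induction Q using MvPolynomial.induction_on with
    | C a => simp
    | add p q hp hq =>
      simp only [map_add]
      exact hp.add hq
    | mul_X p ij hp =>
      simp only [map_mul, MvPolynomial.eval_X]
      exact hp.mul (differentiable_exp_entry A ij.1 ij.2)
  have hreal : ∀ t : ℝ, MvPolynomial.eval
      (fun ij : Fin N × Fin N => (NormedSpace.exp ((t : ℂ) • A)) ij.1 ij.2) P = 0 := by
    intro t
    have := (hS _).1 (hA t).1 P hP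
    rwa [Complex.coe_smul]
  have hfreq : ∃ᶠ w in 𝓝[≠] (0 : ℂ), MvPolynomial.eval
      (fun ij : Fin N × Fin N => (NormedSpace.exp (w • A)) ij.1 ij.2) P = 0 := by
    have hlim : Tendsto (fun n : ℕ => (((1 / ((n : ℝ) + 1)) : ℝ) : ℂ)) atTop (𝓝[≠] 0) := by
      refine tendsto_nhdsWithin_iff.2 ⟨?_, Eventually.of_forall fun n => ?_⟩
      · have := (Complex.continuous_ofReal.tendsto 0).comp
          (tendsto_one_div_add_atTop_nhds_zero_nat (𝕜 := ℝ))
        exact this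
      · have : (1 / ((n : ℝ) + 1)) ≠ 0 := by positivity
        exact Complex.ofReal_ne_zero.2 this
    exact hlim.frequently (Frequently.of_forall fun n => hreal _)
  have hana : AnalyticOnNhd ℂ (fun w : ℂ => MvPolynomial.eval
      (fun ij : Fin N × Fin N => (NormedSpace.exp (w • A)) ij.1 ij.2) P) Set.univ :=
    (hdiff P).differentiableOn.analyticOnNhd isOpen_univ
  exact congrFun (hana.eq_of_frequently_eq (g := fun _ => 0) analyticOnNhd_const hfreq) z

/-- The adjoint action of `K` on `𝔨`. -/
def Ad (k : G.compactForm) (ξ : G.lieK) : G.lieK :=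
  ⟨((k : GL (Fin N) ℂ) : Matrix (Fin N) (Fin N) ℂ) * ξ.1 *
      (((k : GL (Fin N) ℂ)⁻¹ : GL (Fin N) ℂ) : Matrix (Fin N) (Fin N) ℂ), by
    intro t
    have h : t • (((k : GL (Fin N) ℂ) : Matrix (Fin N) (Fin N) ℂ) * ξ.1 *
        (((k : GL (Fin N) ℂ)⁻¹ : GL (Fin N) ℂ) : Matrix (Fin N) (Fin N) ℂ)) =
        ((k : GL (Fin N) ℂ) : Matrix (Fin N) (Fin N) ℂ) * (t • ξ.1) *
        (((k : GL (Fin N) ℂ)⁻¹ : GL (Fin N) ℂ) : Matrix (Fin N) (Fin N) ℂ) := by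
      rw [Matrix.mul_smul, Matrix.smul_mul]
    rw [h, expGL_conj]
    exact mul_mem (mul_mem k.2 (ξ.2 t)) (inv_mem k.2)⟩

/-- The inclusion `K → G`. -/
def ofK (k : G.compactForm) : G.grp := ⟨k, k.2.1⟩

/-- The element `exp (z ξ)` of `G`, for `ξ ∈ 𝔨` and a complex number `z`. -/
noncomputable def exp (z : ℂ) (ξ : G.lieK) : G.grp :=
  ⟨expGL (z • (ξ : Matrix (Fin N) (Fin N) ℂ)), G.exp_mem_grp z ξ.2⟩

/-- A (compact) torus in `K`: a closed, connected, commutative subgroup. -/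
structure IsTorus (T : Subgroup (GL (Fin N) ℂ)) : Prop where
  le : T ≤ G.compactForm
  isClosed : IsClosed (T : Set (GL (Fin N) ℂ))
  isConnected : IsConnected (T : Set (GL (Fin N) ℂ))
  comm : ∀ a ∈ T, ∀ b ∈ T, a * b = b * a

/-- The Lie algebra `𝔱 ⊆ 𝔨` of a subgroup `T` of `K`. -/
def lieOf (T : Subgroup (GL (Fin N) ℂ)) : Set G.lieK :=
  {ξ | ∀ t : ℝ, expGL (t • (ξ : Matrix (Fin N) (Fin N) ℂ)) ∈ T}

/-- The elements `𝔨_T` of `𝔨` that commute with the Lie algebra of `T`. -/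
def lieCentralizer (T : Subgroup (GL (Fin N) ℂ)) : Set G.lieK :=
  {ξ | ∀ β ∈ G.lieOf T, (ξ : Matrix (Fin N) (Fin N) ℂ) * (β : Matrix (Fin N) (Fin N) ℂ) =
    (β : Matrix (Fin N) (Fin N) ℂ) * (ξ : Matrix (Fin N) (Fin N) ℂ)}

/-- An inner product on `𝔨` invariant under the adjoint action of `K`. -/
structure InvariantInner where
  /-- the bilinear form -/
  form : LinearMap.BilinForm ℝ G.lieK
  symm : ∀ ξ η, form ξ η = form η ξ
  pos : ∀ ξ, ξ ≠ 0 → 0 < form ξ ξ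
  invariant : ∀ (k : G.compactForm) (ξ η : G.lieK), form (G.Ad k ξ) (G.Ad k η) = form ξ η

namespace InvariantInner

variable {G}
variable (B : G.InvariantInner)

theorem nondegenerate : B.form.Nondegenerate := by
  constructor
  · intro ξ h
    by_contra hξ
    exact (B.pos ξ hξ).ne' (h ξ)
  · intro ξ h
    by_contra hξ
    exact (B.pos ξ hξ).ne' (h ξ)

/-- The squared norm of an element of `𝔨`. -/
noncomputable def normSq (ξ : G.lieK) : ℝ := B.form ξ ξ

/-- The element of `𝔨` that corresponds to an element of `𝔨*` under the inner product. -/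
noncomputable def sharp (l : Module.Dual ℝ G.lieK) : G.lieK :=
  (B.form.toDual B.nondegenerate).symm l

theorem form_sharp (l : Module.Dual ℝ G.lieK) (ξ : G.lieK) : B.form (B.sharp l) ξ = l ξ := by
  simp [sharp]

end InvariantInner

end ComplexReductiveGroup

/-! ### Holomorphic line bundles with a Hermitian metric -/

section Bundle

variable {E : Type*} [NormedAddCommGroup E] [NormedSpace ℂ E]
variable {X : Type*} [TopologicalSpace X] [ChartedSpace E X]
variable (L : X → Type*) [TopologicalSpace (TotalSpace ℂ L)] [∀ x, TopologicalSpace (L x)]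
  [∀ x, AddCommGroup (L x)] [∀ x, Module ℂ (L x)] [FiberBundle ℂ L] [VectorBundle ℂ ℂ L]

/-- A smooth Hermitian metric on the line bundle `L`, given by `v ↦ |v|²` on each fibre. -/
structure HermitianMetric where
  /-- the squared norm on the fibres -/
  normSq : ∀ x, L x → ℝ
  smul : ∀ x (c : ℂ) (v : L x), normSq x (c • v) = ‖c‖ ^ 2 * normSq x v
  pos : ∀ x (v : L x), v ≠ 0 → 0 < normSq x v
  smooth : ContMDiff (𝓘(ℝ, E).prod 𝓘(ℝ, ℂ)) 𝓘(ℝ, ℝ) ∞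
    (fun p : TotalSpace ℂ L => normSq p.proj p.2)

/-- The holomorphic frame of `L` near `x` given by the preferred trivialization at `x`. -/
noncomputable def frame (x y : X) : L y := (trivializationAt ℂ L x).symm y 1

namespace HermitianMetric

variable {L}
variable (h : HermitianMetric (E := E) L)

/-- `- log |s|²` for the frame `s` near `x`, in the holomorphic chart at `x`. -/
noncomputable def potential (x : X) (z : E) : ℝ :=
  - Real.log (h.normSq ((chartAt E x).symm z) (frame L x ((chartAt E x).symm z)))

/-- First (real) derivative of the potential at `x`. -/
noncomputable def dPotential (x : X) (v : E) : ℝ :=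
  fderiv ℝ (h.potential x) (chartAt E x x) v

/-- Second (real) derivative of the potential at `x`. -/
noncomputable def ddPotential (x : X) (v w : E) : ℝ :=
  fderiv ℝ (fderiv ℝ (h.potential x)) (chartAt E x x) v w

/-- The connection form `θ = ∂ log |s|²` at `x` of the Chern connection in the frame `s`;
here `∂ u (v) = (du(v) - i du(iv)) / 2`. -/
noncomputable def chernForm (x : X) (v : E) : ℂ :=
  -((h.dPotential x v : ℂ) - Complex.I * (h.dPotential x (Complex.I • v) : ℂ)) / 2

/-- The real `(1,1)`-form `ω = i F = - i ∂∂̄ log |s|²`, where `F = - i ω` is the curvature of the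
Chern connection; here `i ∂∂̄ u (v, w) = (D²u(w, iv) - D²u(v, iw)) / 2`. -/
noncomputable def kahlerForm (x : X) (v w : TangentSpace 𝓘(ℝ, E) x) : ℝ :=
  let v' : E := v
  let w' : E := w
  (h.ddPotential x w' (Complex.I • v') - h.ddPotential x v' (Complex.I • w')) / 2

/-- The metric is positively curved, i.e. `ω` is a Kähler form. -/
def IsPositive : Prop :=
  ∀ (x : X) (v : E), v ≠ 0 → 0 < h.kahlerForm x v (Complex.I • v : E)

end HermitianMetric

/-! ### Group actions, moment maps, compatible linearisations -/

variable {N : ℕ} (G : ComplexReductiveGroup N)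
  [MulAction G.grp X] [MulAction G.grp (TotalSpace ℂ L)]

/-- `G` acts holomorphically on `X`, with a lift to a holomorphic action on the line bundle `L` that
is linear on the fibres. Since `𝔨` spans the Lie algebra of `G` over `ℂ`, holomorphy in the group
variable amounts to holomorphy in `z` of the actions of `exp (z ξ)`, `ξ ∈ 𝔨`. -/
structure IsLinearisedAction : Prop where
  continuous_base : Continuous fun q : G.grp × X => q.1 • q.2
  continuous_total : Continuous fun q : G.grp × TotalSpace ℂ L => q.1 • q.2
  holomorphic_base : ∀ g : G.grp, ContMDiff 𝓘(ℂ, E) 𝓘(ℂ, E) ω fun x : X => g • x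
  holomorphic_total : ∀ g : G.grp, ContMDiff (𝓘(ℂ, E).prod 𝓘(ℂ, ℂ)) (𝓘(ℂ, E).prod 𝓘(ℂ, ℂ)) ω
    fun p : TotalSpace ℂ L => g • p
  holomorphic_exp_base : ∀ ξ : G.lieK, ContMDiff (𝓘(ℂ, ℂ).prod 𝓘(ℂ, E)) 𝓘(ℂ, E) ω
    fun q : ℂ × X => G.exp q.1 ξ • q.2
  holomorphic_exp_total : ∀ ξ : G.lieK,
    ContMDiff (𝓘(ℂ, ℂ).prod (𝓘(ℂ, E).prod 𝓘(ℂ, ℂ))) (𝓘(ℂ, E).prod 𝓘(ℂ, ℂ)) ω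
      fun q : ℂ × TotalSpace ℂ L => G.exp q.1 ξ • q.2
  proj_smul : ∀ (g : G.grp) (p : TotalSpace ℂ L), (g • p).proj = g • p.proj
  linear : ∀ (g : G.grp) (c : ℂ) (x : X) (v : L x),
    g • (⟨x, c • v⟩ : TotalSpace ℂ L) =
      ⟨(g • (⟨x, v⟩ : TotalSpace ℂ L)).proj, c • (g • (⟨x, v⟩ : TotalSpace ℂ L)).2⟩

/-- The value `σ_x(ξ)` at `x` of the vector field on `X` induced by `ξ ∈ 𝔨`. -/
noncomputable def infinitesimal (ξ : G.lieK) (x : X) : E :=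
  deriv (fun t : ℝ => chartAt E x (G.exp t ξ • x)) 0

/-- The coordinate on the fibres of `L` near `x`, with respect to the frame at `x`. -/
noncomputable def fibreCoord (x : X) (p : TotalSpace ℂ L) : ℂ := (trivializationAt ℂ L x p).2

variable {L}
variable (h : HermitianMetric (E := E) L)

/-- `K` acts on `X` by symplectomorphisms of `ω`. -/
def PreservesForm : Prop :=
  ∀ (k : G.compactForm) (x : X) (v w : TangentSpace 𝓘(ℝ, E) x),
    h.kahlerForm (G.ofK k • x)
      (mfderiv 𝓘(ℝ, E) 𝓘(ℝ, E) (fun y : X => G.ofK k • y) x v)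
      (mfderiv 𝓘(ℝ, E) 𝓘(ℝ, E) (fun y : X => G.ofK k • y) x w) = h.kahlerForm x v w

/-- `μ : X → 𝔨*` is a moment map for the action of `K` on `(X, ω)`: it is smooth, equivariant, and
`d⟨μ, ξ⟩ = ω(σ(ξ), ·)` for all `ξ ∈ 𝔨`. -/
structure IsMomentMap (μ : X → Module.Dual ℝ G.lieK) : Prop where
  smooth : ∀ ξ : G.lieK, ContMDiff 𝓘(ℝ, E) 𝓘(ℝ, ℝ) ∞ fun x : X => μ x ξ
  equivariant : ∀ (k : G.compactForm) (x : X) (ξ : G.lieK),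
    μ (G.ofK k • x) (G.Ad k ξ) = μ x ξ
  hamiltonian : ∀ (ξ : G.lieK) (x : X) (v : TangentSpace 𝓘(ℝ, E) x),
    mfderiv 𝓘(ℝ, E) 𝓘(ℝ, ℝ) (fun y : X => μ y ξ) x v =
      h.kahlerForm x (infinitesimal G ξ x : E) v

/-- The linearisation is the one determined by the moment map: the vector field on `L` induced by
`ξ ∈ 𝔨` is `ṽ_ξ + i⟨μ, ξ⟩ t`, where `ṽ_ξ` is the horizontal lift (for the Chern connection) of the
vector field on `X`, and `t` is the canonical vertical vector field. In the fibre coordinate `c` of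
the frame, the vertical component of `ṽ_ξ` is `-θ(σ(ξ)) c` and that of `t` is `c`. -/
def IsCompatible (μ : X → Module.Dual ℝ G.lieK) : Prop :=
  ∀ (ξ : G.lieK) (p : TotalSpace ℂ L),
    HasDerivAt (fun t : ℝ => fibreCoord L p.proj (G.exp t ξ • p))
      ((-h.chernForm p.proj (infinitesimal G ξ p.proj) + Complex.I * (μ p.proj ξ : ℂ)) *
        fibreCoord L p.proj p) 0

variable (L)

/-- `F_y(ξ)`, for `ξ ∈ 𝔨` fixing `y`: if `exp (t ξ)` acts on the line `L_y` as `exp (i w t)`, so that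
`w` is the weight of `ξ` on `L_y`, then `F_y(ξ) = - w`. -/
noncomputable def futaki (y : X) (ξ : G.lieK) : ℝ :=
  -(deriv (fun t : ℝ => fibreCoord L y (G.exp t ξ • (⟨y, frame L y y⟩ : TotalSpace ℂ L))) 0).im

/-- The modified weight `F_{y,χ}(ξ) = F_y(ξ) - ⟨ξ, χ⟩`. -/
noncomputable def modifiedFutaki (B : G.InvariantInner) (χ : G.lieK) (y : X) (ξ : G.lieK) : ℝ :=
  futaki L G y ξ - B.form ξ χ

/-- `χ` is the extremal vector field of the torus `T` fixing `x`: the element of `𝔱` that represents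
`F_x` restricted to `𝔱` under the inner product. -/
structure IsExtremalField (B : G.InvariantInner) (T : Subgroup (GL (Fin N) ℂ)) (x : X)
    (χ : G.lieK) : Prop where
  mem : χ ∈ G.lieOf T
  dual : ∀ β ∈ G.lieOf T, futaki L G x β = B.form β χ

end Bundle

end KempfNess

namespace KempfNess

open Bundle Filter

/-! ### Logarithms of positive elements in a C⋆-algebra -/

section CStar

variable {A : Type*} [CStarAlgebra A] [PartialOrder A] [StarOrderedRing A]

/-! The core is a moment-weight inequality, `exists_moment_le`: if exp(itξ)x → x₀ as t → -∞, then
for every g ∈ G some k ∈ K satisfies ⟨μ(gx), Ad_k ξ⟩ ≥ ⟨μ(x₀), ξ⟩. To see it, write g = kb with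
exp(itξ) b exp(-itξ) → p, where p commutes with ξ (`exists_parabolic_decomposition`). Then
exp(itξ)bx → px₀. The function ⟨μ, ξ⟩ is nondecreasing along this flow, its derivative being ω(σ,
iσ) ≥ 0 (σ the vector field of ξ), so its value at bx is at least its value at px₀. The latter is
the weight of ξ on the fibre over px₀, and p identifies that fibre with the one over x₀
(`moment_smul_of_commute`). Equivariance of μ passes from bx to gx = kbx.

The decomposition comes from matrices. For X = iξ, a QR factorisation adapted to the ordered
eigenvalues of X gives a Hermitian Y for which exp(tY) g exp(-tX) converges to an invertible q.
Operator monotonicity of the logarithm shows that Y is the limit of log(g exp(2nX) g⋆)/2n. Since G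
is algebraic, these logarithms lie in i𝔨, hence so does Y, and q ∈ G. As q conjugates X to Y, its
polar decomposition q = kp has p commuting with X, and k is the required element.

For the theorem, apply the inequality to ξ = sα - (1 + sr)χ, s > 0, with rχ the orthogonal
projection of α to χ. Since χ fixes x and commutes with α, exp(itξ)x still tends to x₀. With m the
modified weight, ⟨μ(x₀), ξ⟩ = -sm + ‖χ‖² and ‖ξ‖² ≤ s²‖α‖² + ‖χ‖². Cauchy–Schwarz bounds ‖μ(gx)‖²
below by (-sm + ‖χ‖²)²/(s²‖α‖² + ‖χ‖²), and s = -m/‖α‖² gives the claim. -/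

theorem isStrictlyPositive_mul_star {g : A} (hg : IsUnit g) : IsStrictlyPositive (g * star g) :=
  IsStrictlyPositive.iff_of_unital.2 ⟨mul_star_self_nonneg g, hg.mul hg.star⟩

theorem isStrictlyPositive_exp {X : A} (hX : IsSelfAdjoint X) :
    IsStrictlyPositive (NormedSpace.exp X) := by
  let _ : NormedAlgebra ℚ A := NormedAlgebra.restrictScalars ℚ ℝ A
  exact IsStrictlyPositive.iff_of_unital.2 ⟨hX.exp_nonneg, NormedSpace.isUnit_exp X⟩

theorem log_smul_exp {X : A} (hX : IsSelfAdjoint X) {c : ℝ} (hc : 0 < c) :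
    CFC.log (c • NormedSpace.exp X) = algebraMap ℝ A (Real.log c) + X := by
  rw [CFC.log_smul' _ hc (isStrictlyPositive_exp hX), CFC.log_exp X hX]

/-- If `h` lies between two multiples of `exp X`, its logarithm is close to `X`. -/
theorem norm_log_sub_le {X h : A} (hX : IsSelfAdjoint X) {c C : ℝ} (hc : 0 < c) (hC : 0 < C)
    (h₁ : c • NormedSpace.exp X ≤ h) (h₂ : h ≤ C • NormedSpace.exp X) :
    ‖CFC.log h - X‖ ≤ (|Real.log c| + |Real.log C|) * ‖(1 : A)‖ * 2 := by
  have hp : IsStrictlyPositive (c • NormedSpace.exp X) := (isStrictlyPositive_exp hX).smul hc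
  have l₁ := CFC.log_le_log h₁ hp
  have l₂ := CFC.log_le_log h₂ (hp.of_le h₁)
  rw [log_smul_exp hX hc] at l₁
  rw [log_smul_exp hX hC] at l₂
  have e₁ : 0 ≤ CFC.log h - X - algebraMap ℝ A (Real.log c) := by
    rw [sub_sub, add_comm X]; exact sub_nonneg.2 l₁
  have e₂ : CFC.log h - X - algebraMap ℝ A (Real.log c) ≤
      algebraMap ℝ A (Real.log C) - algebraMap ℝ A (Real.log c) :=
    sub_le_sub_right (sub_le_iff_le_add.2 l₂) _
  have e₃ := CStarAlgebra.norm_le_norm_of_nonneg_of_le e₁ e₂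
  have n₁ : ‖algebraMap ℝ A (Real.log c)‖ = |Real.log c| * ‖(1 : A)‖ := by
    rw [norm_algebraMap, Real.norm_eq_abs]
  have n₂ : ‖algebraMap ℝ A (Real.log C)‖ = |Real.log C| * ‖(1 : A)‖ := by
    rw [norm_algebraMap, Real.norm_eq_abs]
  have t₁ := norm_sub_le (algebraMap ℝ A (Real.log C)) (algebraMap ℝ A (Real.log c))
  have t₂ := norm_add_le (CFC.log h - X - algebraMap ℝ A (Real.log c))
    (algebraMap ℝ A (Real.log c))
  rw [sub_add_cancel] at t₂
  -- The triangle inequalities give (|log C| + 2|log c|)‖1‖; this sign allows rounding up to the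
  -- symmetric bound.
  have p₂ : 0 ≤ |Real.log C| * ‖(1 : A)‖ := by positivity
  rw [n₁, n₂] at t₁
  rw [n₁] at t₂
  linarith

/-- Conjugate s s⋆ ≤ ‖s s⋆‖ by r. This turns a bound on the inverse s into a lower bound for r r⋆.
-/
theorem le_smul_mul_star {r s : A} (hrs : r * s = 1) :
    (1 : A) ≤ ‖s * star s‖ • (r * star r) := by
  have h : s * star s ≤ algebraMap ℝ A ‖s * star s‖ :=
    IsSelfAdjoint.le_algebraMap_norm_self (IsSelfAdjoint.mul_star_self s)
  have h' := star_right_conjugate_le_conjugate h r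
  have e : r * (s * star s) * star r = 1 := by
    rw [← mul_assoc, hrs, one_mul, ← star_mul, hrs, star_one]
  rw [e, Algebra.algebraMap_eq_smul_one, mul_smul_comm, smul_mul_assoc, mul_one] at h'
  exact h'

/-- If `exp (- t Y) g exp (t X)` converges to an invertible element as `t → ∞`, then
`log (g exp (2 t X) g⋆) / 2 t → Y`. -/
theorem tendsto_log_conj_exp {X Y : A} (hX : IsSelfAdjoint X) (hY : IsSelfAdjoint Y) (g q : Aˣ)
    (hq : Tendsto (fun n : ℕ => NormedSpace.exp (-(n : ℝ) • Y) * g * NormedSpace.exp ((n : ℝ) • X))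
      atTop (𝓝 (q : A))) :
    Tendsto (fun n : ℕ => (1 / (2 * ((n : ℝ)))) •
      CFC.log ((g : A) * NormedSpace.exp ((2 * (n : ℝ)) • X) * star (g : A))) atTop (𝓝 Y) := by
  let _ : NormedAlgebra ℚ A := NormedAlgebra.restrictScalars ℚ ℝ A
  have expadd : ∀ (Z : A) (a b : ℝ), NormedSpace.exp (a • Z) * NormedSpace.exp (b • Z) =
      NormedSpace.exp ((a + b) • Z) := by
    intro Z a b
    rw [add_smul, NormedSpace.exp_add_of_commute]
    exact (Commute.refl Z).smul_left a |>.smul_right b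
  have starexp : ∀ (Z : A) (hZ : IsSelfAdjoint Z) (a : ℝ),
      star (NormedSpace.exp (a • Z)) = NormedSpace.exp (a • Z) := by
    intro Z hZ a
    rw [NormedSpace.star_exp, star_smul, hZ.star_eq, star_trivial]
  set r : ℕ → A := fun n => NormedSpace.exp (-(n : ℝ) • Y) * g * NormedSpace.exp ((n : ℝ) • X)
    with hr
  set s : ℕ → A := fun n => NormedSpace.exp (-(n : ℝ) • X) * (g⁻¹ : Aˣ) *
    NormedSpace.exp ((n : ℝ) • Y) with hs
  have hrs : ∀ n, r n * s n = 1 := by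
    intro n
    have e1 := expadd X n (-n)
    have e2 := expadd Y (-n) n
    simp only [add_neg_cancel, neg_add_cancel, zero_smul, NormedSpace.exp_zero] at e1 e2
    calc r n * s n = NormedSpace.exp (-(n : ℝ) • Y) * g * (NormedSpace.exp ((n : ℝ) • X) *
          NormedSpace.exp (-(n : ℝ) • X)) * (g⁻¹ : Aˣ) * NormedSpace.exp ((n : ℝ) • Y) := by
          simp only [hr, hs, mul_assoc]
      _ = 1 := by rw [e1, mul_one, mul_assoc _ (g : A), Units.mul_inv, mul_one, e2]
  have hsr : ∀ n, s n * r n = 1 := by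
    intro n
    have e1 := expadd X (-n) n
    have e2 := expadd Y n (-n)
    simp only [add_neg_cancel, neg_add_cancel, zero_smul, NormedSpace.exp_zero] at e1 e2
    calc s n * r n = NormedSpace.exp (-(n : ℝ) • X) * (g⁻¹ : Aˣ) * (NormedSpace.exp ((n : ℝ) • Y) *
          NormedSpace.exp (-(n : ℝ) • Y)) * g * NormedSpace.exp ((n : ℝ) • X) := by
          simp only [hr, hs, mul_assoc]
      _ = 1 := by rw [e2, mul_one, mul_assoc _ ((g⁻¹ : Aˣ) : A), Units.inv_mul, mul_one, e1]
  -- Since s n is the inverse of r n and inversion is continuous at units, both sequences are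
  -- bounded. So r r⋆ stays between two positive constants.
  have hslim : Tendsto s atTop (𝓝 ((q⁻¹ : Aˣ) : A)) := by
    have h1 := (NormedRing.inverse_continuousAt q).tendsto.comp hq
    rw [Ring.inverse_unit] at h1
    refine h1.congr fun n => ?_
    exact Ring.inverse_unit (⟨r n, s n, hrs n, hsr n⟩ : Aˣ)
  obtain ⟨C₀, hC₀⟩ := ((hq.mul hq.star).norm.isBoundedUnder_le : IsBoundedUnder _ _ _)
  obtain ⟨c₀, hc₀⟩ := ((hslim.mul hslim.star).norm.isBoundedUnder_le : IsBoundedUnder _ _ _)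
  rw [eventually_map] at hC₀ hc₀
  set C := |C₀| + 1
  set c := |c₀| + 1
  have hC : 0 < C := by positivity
  have hc : 0 < c := by positivity
  rw [tendsto_iff_norm_sub_tendsto_zero]
  set M := (|Real.log c⁻¹| + |Real.log C|) * ‖(1 : A)‖ * 2
  have hlim : Tendsto (fun n : ℕ => M / 2 * (1 / (n : ℝ))) atTop (𝓝 0) := by
    simpa using (tendsto_one_div_atTop_nhds_zero_nat (𝕜 := ℝ)).const_mul (M / 2)
  refine squeeze_zero' (Eventually.of_forall fun _ => norm_nonneg _) ?_ hlim
  filter_upwards [hC₀, hc₀, eventually_gt_atTop 0] with n h1 h2 hn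
  have hn' : (0 : ℝ) < n := by exact_mod_cast hn
  have eh : (g : A) * NormedSpace.exp ((2 * (n : ℝ)) • X) * star (g : A) =
      NormedSpace.exp ((n : ℝ) • Y) * (r n * star (r n)) * NormedSpace.exp ((n : ℝ) • Y) := by
    have e2 := expadd Y n (-n)
    have e3 := expadd Y (-n) n
    have e1 := expadd X n n
    simp only [add_neg_cancel, neg_add_cancel, zero_smul, NormedSpace.exp_zero] at e2 e3
    rw [← two_mul] at e1
    simp only [hr, star_mul, starexp X hX, starexp Y hY]
    calc _ = (NormedSpace.exp ((n : ℝ) • Y) * NormedSpace.exp (-(n : ℝ) • Y)) * (g : A) *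
        (NormedSpace.exp ((n : ℝ) • X) * NormedSpace.exp ((n : ℝ) • X)) *
        star (g : A) * (NormedSpace.exp (-(n : ℝ) • Y) * NormedSpace.exp ((n : ℝ) • Y)) := by
          rw [e1, e2, e3, one_mul, mul_one]
      _ = _ := by simp only [mul_assoc]
  have upper : r n * star (r n) ≤ algebraMap ℝ A C := by
    refine (IsSelfAdjoint.le_algebraMap_norm_self (IsSelfAdjoint.mul_star_self _)).trans ?_
    refine algebraMap_mono A ?_
    exact h1.trans ((le_abs_self _).trans (by simp [C]))
  have lower : algebraMap ℝ A c⁻¹ ≤ r n * star (r n) := by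
    have h3 := le_smul_mul_star (hrs n)
    have h4 : (1 : A) ≤ c • (r n * star (r n)) := by
      refine h3.trans (smul_le_smul_of_nonneg_right ?_ (mul_star_self_nonneg _))
      exact h2.trans ((le_abs_self _).trans (by simp [c]))
    have h5 := smul_le_smul_of_nonneg_left h4 (inv_nonneg.2 hc.le)
    rw [smul_smul, inv_mul_cancel₀ hc.ne', one_smul] at h5
    rwa [Algebra.algebraMap_eq_smul_one]
  have conj : ∀ a : ℝ, NormedSpace.exp ((n : ℝ) • Y) * algebraMap ℝ A a *
      NormedSpace.exp ((n : ℝ) • Y) = a • NormedSpace.exp ((2 * (n : ℝ)) • Y) := by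
    intro a
    rw [Algebra.algebraMap_eq_smul_one, mul_smul_comm, mul_one, smul_mul_assoc, expadd, two_mul]
  have sE : star (NormedSpace.exp ((n : ℝ) • Y)) = NormedSpace.exp ((n : ℝ) • Y) := starexp Y hY n
  have u1 := star_right_conjugate_le_conjugate upper (NormedSpace.exp ((n : ℝ) • Y))
  have u2 := star_right_conjugate_le_conjugate lower (NormedSpace.exp ((n : ℝ) • Y))
  rw [sE, ← eh, conj] at u1 u2
  -- The logarithm stays within the constant M of 2nY, so division by 2n gives convergence.
  have hb := norm_log_sub_le ((IsSelfAdjoint.all (2 * (n : ℝ))).smul hY) (inv_pos.2 hc) hC u2 u1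
  set l := CFC.log ((g : A) * NormedSpace.exp ((2 * (n : ℝ)) • X) * star (g : A))
  have e : (1 / (2 * (n : ℝ))) • l - Y = (1 / (2 * (n : ℝ))) • (l - (2 * (n : ℝ)) • Y) := by
    rw [smul_sub, smul_smul, one_div_mul_cancel (by positivity), one_smul]
  rw [e, norm_smul, Real.norm_eq_abs, abs_of_pos (by positivity)]
  calc _ ≤ 1 / (2 * (n : ℝ)) * M := by gcongr
    _ = _ := by field_simp

end CStar

/-! ### One-parameter groups of Hermitian matrices in algebraic groups -/

section MatrixExp

variable {N : ℕ}

@[simp] theorem coe_expGL (A : Matrix (Fin N) (Fin N) ℂ) :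
    (expGL A : Matrix (Fin N) (Fin N) ℂ) = NormedSpace.exp A := rfl

theorem expGL_add_of_commute {A B : Matrix (Fin N) (Fin N) ℂ} (h : Commute A B) :
    expGL (A + B) = expGL A * expGL B :=
  Units.ext (Matrix.exp_add_of_commute A B h)

@[simp] theorem expGL_zero : expGL (0 : Matrix (Fin N) (Fin N) ℂ) = 1 :=
  Units.ext (by simp)

theorem expGL_nsmul (n : ℕ) (A : Matrix (Fin N) (Fin N) ℂ) : expGL ((n : ℂ) • A) = expGL A ^ n := by
  rw [Nat.cast_smul_eq_nsmul]
  exact Units.ext (by simpa using Matrix.exp_nsmul n A)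

theorem commute_expGL {A : Matrix (Fin N) (Fin N) ℂ} {g : GL (Fin N) ℂ}
    (h : Commute (g : Matrix (Fin N) (Fin N) ℂ) A) : expGL A * g = g * expGL A := by
  have e := expGL_conj g A
  rw [h.eq, mul_assoc, ← Units.val_mul, mul_inv_cancel, Units.val_one, mul_one] at e
  rw [eq_mul_inv_iff_mul_eq] at e
  exact e

/-- The value at `z` of the exponential polynomial `∑ aₗ exp (l z)`. -/
noncomputable def expPoly : AddMonoidAlgebra ℂ ℝ →ₐ[ℂ] (ℂ → ℂ) :=
  AddMonoidAlgebra.lift ℂ (ℂ → ℂ) ℝ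
    { toFun := fun l z => Complex.exp (l.toAdd * z)
      map_one' := by ext; simp
      map_mul' := by intro a b; ext z; simp [add_mul, Complex.exp_add] }

theorem expPoly_single (l : ℝ) (c : ℂ) (z : ℂ) :
    expPoly (AddMonoidAlgebra.single l c) z = c * Complex.exp (l * z) := by
  simp [expPoly, AddMonoidAlgebra.lift_single]

/-- An exponential polynomial with real exponents that vanishes on `ℕ` is zero. -/
theorem expPoly_eq_zero (a : AddMonoidAlgebra ℂ ℝ) (h : ∀ n : ℕ, expPoly a n = 0) : a = 0 := by
  -- The characters n ↦ exp(ln) of ℕ are distinct for distinct real l, hence linearly independent by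
  -- Dedekind.
  let χ : ℝ → (Multiplicative ℕ →* ℂ) := fun l => powersHom ℂ (Complex.exp l)
  have hχ : Function.Injective χ := by
    intro l m hlm
    have h1 := (powersHom ℂ).injective hlm
    rw [← Complex.ofReal_exp, ← Complex.ofReal_exp] at h1
    exact Real.exp_injective (Complex.ofReal_injective h1)
  have hli := (linearIndependent_monoidHom (Multiplicative ℕ) ℂ).comp χ hχ
  have key : ∀ b : AddMonoidAlgebra ℂ ℝ, ∀ n : ℕ,
      Finsupp.linearCombination ℂ (fun l => (χ l : Multiplicative ℕ → ℂ)) b.coeff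
        (Multiplicative.ofAdd n) = expPoly b n := by
    intro b n
    induction b using AddMonoidAlgebra.induction_linear with
    | zero => simp
    | add f g hf hg => simp [hf, hg]
    | single l c =>
      rw [expPoly_single]
      simp [χ, ← Complex.exp_nat_mul, mul_comm]
  apply AddMonoidAlgebra.coeff_injective
  refine (linearIndependent_iff.1 hli) a.coeff (funext fun n => ?_)
  exact (key a n.toAdd).trans (h n.toAdd)

/-- A Hermitian matrix is unitarily diagonalisable, with eigenvalues in decreasing order. -/
theorem exists_antitone_diagonal {H : Matrix (Fin N) (Fin N) ℂ} (hH : H.IsHermitian) :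
    ∃ u ∈ Matrix.unitaryGroup (Fin N) ℂ, ∃ d : Fin N → ℝ, Antitone d ∧
      H = u * Matrix.diagonal (fun i => (d i : ℂ)) * star u := by
  set σ := Tuple.sort fun i => -hH.eigenvalues i
  have hσ : Monotone ((fun i => -hH.eigenvalues i) ∘ σ) := Tuple.monotone_sort _
  set u₀ : Matrix (Fin N) (Fin N) ℂ := (hH.eigenvectorUnitary).1 with hu₀
  have hu : star u₀ * u₀ = 1 := Unitary.coe_star_mul_self hH.eigenvectorUnitary
  have hs : H = u₀ * Matrix.diagonal (fun i => (hH.eigenvalues i : ℂ)) * star u₀ := by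
    have := hH.spectral_theorem
    rw [Unitary.conjStarAlgAut_apply] at this
    exact this
  refine ⟨u₀.submatrix id σ, ?_, hH.eigenvalues ∘ σ, fun i j hij => ?_, ?_⟩
  · rw [Matrix.mem_unitaryGroup_iff']
    change (star u₀).submatrix σ id * _ = 1
    rw [← Matrix.submatrix_mul _ _ _ _ _ Function.bijective_id, hu, Matrix.submatrix_one_equiv]
  · exact neg_le_neg_iff.1 (hσ hij)
  · have e : Matrix.diagonal (fun i => ((hH.eigenvalues ∘ σ) i : ℂ)) =
        (Matrix.diagonal (fun i => (hH.eigenvalues i : ℂ))).submatrix σ σ := by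
      rw [Matrix.submatrix_diagonal_equiv]; rfl
    rw [e]
    change _ = _ * _ * (star u₀).submatrix σ id
    rw [← Matrix.submatrix_mul _ _ _ _ _ σ.bijective, ← Matrix.submatrix_mul _ _ _ _ _ σ.bijective,
      ← hs, Matrix.submatrix_id_id]

theorem exp_smul_conj_diagonal {u : Matrix (Fin N) (Fin N) ℂ}
    (hu : u ∈ Matrix.unitaryGroup (Fin N) ℂ) (d : Fin N → ℝ) (z : ℂ) :
    NormedSpace.exp (z • (u * Matrix.diagonal (fun i => (d i : ℂ)) * star u)) =
      u * Matrix.diagonal (fun i => Complex.exp (d i * z)) * star u := by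
  have hinv : u⁻¹ = star u := Matrix.inv_eq_right_inv (Matrix.mem_unitaryGroup_iff.1 hu)
  have hunit : IsUnit u := Unitary.isUnit_coe (U := ⟨u, hu⟩)
  have e : z • (u * Matrix.diagonal (fun i => (d i : ℂ)) * star u) =
      u * Matrix.diagonal (fun i => (d i : ℂ) * z) * u⁻¹ := by
    rw [hinv, ← Matrix.smul_mul, ← Matrix.mul_smul, ← Matrix.diagonal_smul]
    congr 3
    ext i; simp [mul_comm]
  rw [e, Matrix.exp_conj _ _ hunit, Matrix.exp_diagonal, hinv]
  congr 3
  ext i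
  rw [Pi.coe_exp, Complex.exp_eq_exp_ℂ]

/-- If `H` is Hermitian and `exp H` lies in an algebraic group, the whole complex one-parameter
group `exp (z H)` does. -/
theorem ComplexReductiveGroup.expGL_smul_mem (G : ComplexReductiveGroup N)
    {H : Matrix (Fin N) (Fin N) ℂ} (hH : H.IsHermitian) (h : expGL H ∈ G.grp) (z : ℂ) :
    expGL (z • H) ∈ G.grp := by
  obtain ⟨S, hS⟩ := G.algebraic
  rw [hS]
  intro P hP
  obtain ⟨u, hu, d, -, rfl⟩ := exists_antitone_diagonal hH
  set H := u * Matrix.diagonal (fun i => (d i : ℂ)) * star u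
  -- Diagonalising H makes each entry of exp(wH) an exponential polynomial in w, with the
  -- eigenvalues as exponents. A polynomial equation of G evaluated on them is again one, and it
  -- vanishes at every natural number because powers of exp H lie in G.
  let b : Fin N × Fin N → AddMonoidAlgebra ℂ ℝ := fun ij =>
    ∑ k, AddMonoidAlgebra.single (d k) (u ij.1 k * star (u ij.2 k))
  have hb : ∀ (w : ℂ) ij, expPoly (b ij) w = (NormedSpace.exp (w • H)) ij.1 ij.2 := by
    intro w ij
    rw [exp_smul_conj_diagonal hu]
    simp only [b, map_sum, Finset.sum_apply, expPoly_single]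
    rw [Matrix.mul_apply]
    simp only [Matrix.mul_diagonal, Matrix.star_apply]
    exact Finset.sum_congr rfl fun k _ => by ring
  have heval : ∀ w : ℂ, expPoly (MvPolynomial.aeval b P) w =
      MvPolynomial.eval (fun ij => (NormedSpace.exp (w • H)) ij.1 ij.2) P := by
    intro w
    have e : (Pi.evalAlgHom ℂ (fun _ : ℂ => ℂ) w).comp (expPoly.comp (MvPolynomial.aeval b)) =
        MvPolynomial.aeval (fun ij => (NormedSpace.exp (w • H)) ij.1 ij.2) := by
      ext ij
      simp [hb]
    exact (DFunLike.congr_fun e P).trans (by rw [MvPolynomial.aeval_eq_eval])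
  have hzero : MvPolynomial.aeval b P = 0 := by
    refine expPoly_eq_zero _ fun n => ?_
    rw [heval]
    refine (hS (expGL ((n : ℂ) • H))).1 ?_ P hP
    rw [expGL_nsmul]
    exact G.grp.pow_mem h n
  change MvPolynomial.eval (fun ij => (NormedSpace.exp (z • H)) ij.1 ij.2) P = 0
  rw [← heval, hzero, map_zero, Pi.zero_apply]

/-- The complex one-parameter group of H lies in G, and its imaginary part consists of unitary
matrices because H is Hermitian. -/
theorem ComplexReductiveGroup.neg_I_smul_mem_lieK (G : ComplexReductiveGroup N)
    {H : Matrix (Fin N) (Fin N) ℂ} (hH : H.IsHermitian) (h : expGL H ∈ G.grp) :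
    (-Complex.I) • H ∈ G.lieK := by
  intro t
  have e : t • (-Complex.I) • H = ((t : ℂ) * -Complex.I) • H := by
    rw [mul_smul, Complex.coe_smul]
  rw [e]
  refine ⟨G.expGL_smul_mem hH h _, ?_⟩
  rw [Matrix.mem_unitaryGroup_iff, Matrix.star_eq_conjTranspose, coe_expGL,
    ← Matrix.exp_conjTranspose, Matrix.conjTranspose_smul, hH.eq,
    ← Matrix.exp_add_of_commute, ← add_smul]
  · simp
  · exact ((Commute.refl H).smul_left _).smul_right _

end MatrixExp

/-! ### The decomposition G = K P(ξ) -/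

section Parabolic

variable {N : ℕ}

/-- QR factorisation. -/
theorem exists_unitary_upperTriangular (g : Matrix (Fin N) (Fin N) ℂ) :
    ∃ q ∈ Matrix.unitaryGroup (Fin N) ℂ, ∀ i j, j < i → (star q * g) i j = 0 := by
  let v : Fin N → EuclideanSpace ℂ (Fin N) := fun j => WithLp.toLp 2 fun i => g i j
  let b := InnerProductSpace.gramSchmidtOrthonormalBasis (𝕜 := ℂ) (by simp) v
  refine ⟨Matrix.of fun i j => b j i, ?_, fun i j hij => ?_⟩
  · rw [Matrix.mem_unitaryGroup_iff']
    ext i j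
    have := orthonormal_iff_ite.1 b.orthonormal i j
    rw [PiLp.inner_apply] at this
    rw [Matrix.mul_apply, Matrix.one_apply, ← this]
    exact Finset.sum_congr rfl fun k _ => by
      simp [mul_comm]
  · have := InnerProductSpace.gramSchmidtOrthonormalBasis_inv_triangular (𝕜 := ℂ)
      (h := by simp) v hij
    rw [PiLp.inner_apply] at this
    rw [Matrix.mul_apply, ← this]
    exact Finset.sum_congr rfl fun k _ => by
      simp [mul_comm, v, b]

/-- For Hermitian `X` and invertible `g`, there are a Hermitian matrix `Y` and an invertible matrix
`q` such that `exp (t Y) g exp (- t X) → q` as `t → -∞`. -/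
theorem exists_tendsto_exp_mul_exp {X : Matrix (Fin N) (Fin N) ℂ} (hX : X.IsHermitian)
    (g : GL (Fin N) ℂ) : ∃ Y : Matrix (Fin N) (Fin N) ℂ, Y.IsHermitian ∧ ∃ q : GL (Fin N) ℂ,
      Tendsto (fun t : ℝ => NormedSpace.exp ((t : ℂ) • Y) * (g : Matrix (Fin N) (Fin N) ℂ) *
        NormedSpace.exp (((-t : ℝ) : ℂ) • X)) atBot (𝓝 (q : Matrix (Fin N) (Fin N) ℂ)) := by
  obtain ⟨u, hu, d, hd, rfl⟩ := exists_antitone_diagonal hX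
  obtain ⟨v, hv, hR⟩ := exists_unitary_upperTriangular ((g : Matrix (Fin N) (Fin N) ℂ) * u)
  set D := Matrix.diagonal (fun i => (d i : ℂ)) with hD
  set R := star v * ((g : Matrix (Fin N) (Fin N) ℂ) * u) with hRdef
  have hvv : v * star v = 1 := Matrix.mem_unitaryGroup_iff.1 hv
  have huu : u * star u = 1 := Matrix.mem_unitaryGroup_iff.1 hu
  let Rt : ℝ → Matrix (Fin N) (Fin N) ℂ := fun t =>
    Matrix.diagonal (fun i => Complex.exp (d i * (t : ℂ))) * R *
      Matrix.diagonal (fun i => Complex.exp (d i * ((-t : ℝ) : ℂ)))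
  -- Conjugation multiplies entry (i, j) of R by exp((d i - d j)t). Below the diagonal R vanishes;
  -- above it d i ≥ d j, so as t → -∞ only the entries with d i = d j survive.
  let R₀ : Matrix (Fin N) (Fin N) ℂ := Matrix.of fun i j => if d i = d j then R i j else 0
  have hlim : Tendsto Rt atBot (𝓝 R₀) := by
    refine tendsto_pi_nhds.2 fun i => tendsto_pi_nhds.2 fun j => ?_
    have e : ∀ t, Rt t i j = ((Real.exp ((d i - d j) * t) : ℝ) : ℂ) * R i j := by
      intro t
      simp only [Rt, Matrix.mul_diagonal, Matrix.diagonal_mul]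
      rw [mul_right_comm, ← Complex.exp_add, Complex.ofReal_exp]
      congr 2
      push_cast
      ring
    simp only [e, R₀, Matrix.of_apply]
    split_ifs with hij
    · simp [hij]
    · rcases lt_or_ge j i with hji | hji
      · simp [hR i j hji]
      · have hlt : 0 < d i - d j := sub_pos.2 (lt_of_le_of_ne (hd hji) (Ne.symm hij))
        have h1 : Tendsto (fun t : ℝ => Real.exp ((d i - d j) * t)) atBot (𝓝 0) :=
          Real.tendsto_exp_atBot.comp (tendsto_id.const_mul_atBot hlt)
        have h2 := ((Complex.continuous_ofReal.tendsto 0).comp h1).mul_const (R i j)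
        simpa using h2
  have hr : ∀ t : ℝ, NormedSpace.exp ((t : ℂ) • (v * D * star v)) *
      (g : Matrix (Fin N) (Fin N) ℂ) * NormedSpace.exp (((-t : ℝ) : ℂ) • (u * D * star u)) =
        v * Rt t * star u := by
    intro t
    rw [hD, exp_smul_conj_diagonal hu, exp_smul_conj_diagonal hv]
    simp only [Rt, hRdef, mul_assoc]
  -- The determinant is constant along the family, so the limit is invertible.
  have hdet : (v * R₀ * star u).det = (g : Matrix (Fin N) (Fin N) ℂ).det := by
    have h1 : Tendsto (fun t => (v * Rt t * star u).det) atBot (𝓝 (v * R₀ * star u).det) := by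
      have : Continuous fun M : Matrix (Fin N) (Fin N) ℂ => (v * M * star u).det := by fun_prop
      exact (this.tendsto R₀).comp hlim
    refine tendsto_nhds_unique h1 (tendsto_const_nhds.congr fun t => ?_)
    have h2 : (Matrix.diagonal fun i => Complex.exp (d i * (t : ℂ))).det *
        (Matrix.diagonal fun i => Complex.exp (d i * ((-t : ℝ) : ℂ))).det = 1 := by
      rw [← Matrix.det_mul, Matrix.diagonal_mul_diagonal]
      simp [← Complex.exp_add]
    have h3 : v.det * (star v).det = 1 := by rw [← Matrix.det_mul, hvv, Matrix.det_one]
    have h4 : u.det * (star u).det = 1 := by rw [← Matrix.det_mul, huu, Matrix.det_one]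
    simp only [Rt, hRdef, Matrix.det_mul]
    linear_combination (-(g : Matrix (Fin N) (Fin N) ℂ).det) * (h2 * (v.det * (star v).det) *
      (u.det * (star u).det) + h3 * (u.det * (star u).det) + h4)
  refine ⟨v * D * star v, ?_, Matrix.GeneralLinearGroup.mkOfDetNeZero (v * R₀ * star u) ?_, ?_⟩
  · rw [Matrix.IsHermitian, Matrix.star_eq_conjTranspose, Matrix.conjTranspose_mul,
      Matrix.conjTranspose_mul, Matrix.conjTranspose_conjTranspose, hD,
      Matrix.diagonal_conjTranspose, mul_assoc]
    congr 3
    ext i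
    simp
  · rw [hdet]
    exact (Matrix.isUnit_iff_isUnit_det _).1 g.isUnit |>.ne_zero
  · simp only [hr]
    exact (tendsto_const_nhds.mul hlim).mul tendsto_const_nhds

/-- Differentiate at t = 0 the unitarity relation exp(tξ)⋆ = exp(-tξ). -/
theorem star_lieK (G : ComplexReductiveGroup N) (ξ : G.lieK) :
    star (ξ : Matrix (Fin N) (Fin N) ℂ) = -(ξ : Matrix (Fin N) (Fin N) ℂ) := by
  open scoped Matrix.Norms.L2Operator in
  have h1 : ∀ t : ℝ, NormedSpace.exp (t • star (ξ : Matrix (Fin N) (Fin N) ℂ)) =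
      NormedSpace.exp (t • -(ξ : Matrix (Fin N) (Fin N) ℂ)) := by
    intro t
    have h2 := Matrix.mem_unitaryGroup_iff'.1 (ξ.2 t).2
    rw [coe_expGL, Matrix.star_eq_conjTranspose, ← Matrix.exp_conjTranspose,
      Matrix.conjTranspose_smul, star_trivial] at h2
    have h3 : NormedSpace.exp (t • (ξ : Matrix (Fin N) (Fin N) ℂ)) *
        NormedSpace.exp (t • -(ξ : Matrix (Fin N) (Fin N) ℂ)) = 1 := by
      rw [smul_neg]
      exact (expGL (t • (ξ : Matrix (Fin N) (Fin N) ℂ))).mul_inv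
    exact left_inv_eq_right_inv h2 h3
  have d1 := hasDerivAt_exp_smul_const (𝕂 := ℝ) (star (ξ : Matrix (Fin N) (Fin N) ℂ)) (0 : ℝ)
  have d2 := hasDerivAt_exp_smul_const (𝕂 := ℝ) (-(ξ : Matrix (Fin N) (Fin N) ℂ)) (0 : ℝ)
  simp only [h1] at d1
  simpa using d1.unique d2

theorem ComplexReductiveGroup.mem_of_tendsto (G : ComplexReductiveGroup N) {ι : Type*}
    {l : Filter ι} [l.NeBot] {f : ι → GL (Fin N) ℂ} {q : GL (Fin N) ℂ}
    (hf : Tendsto (fun i => (f i : Matrix (Fin N) (Fin N) ℂ)) l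
      (𝓝 (q : Matrix (Fin N) (Fin N) ℂ)))
    (h : ∀ i, f i ∈ G.grp) : q ∈ G.grp := by
  obtain ⟨S, hS⟩ := G.algebraic
  rw [hS]
  intro P hP
  have hc : Continuous fun M : Matrix (Fin N) (Fin N) ℂ =>
      MvPolynomial.eval (fun ij : Fin N × Fin N => M ij.1 ij.2) P :=
    (MvPolynomial.continuous_eval P).comp (by fun_prop)
  refine tendsto_nhds_unique ((hc.tendsto _).comp hf) (tendsto_const_nhds.congr fun i => ?_)
  exact ((hS _).1 (h i) P hP).symm

theorem tendsto_GL_iff {ι : Type*} {l : Filter ι} {f : ι → GL (Fin N) ℂ} {q : GL (Fin N) ℂ} :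
    Tendsto f l (𝓝 q) ↔ Tendsto (fun i => (f i : Matrix (Fin N) (Fin N) ℂ)) l
      (𝓝 (q : Matrix (Fin N) (Fin N) ℂ)) := by
  open scoped Matrix.Norms.L2Operator in
  exact (Units.isOpenEmbedding_val (R := Matrix (Fin N) (Fin N) ℂ)).isEmbedding.tendsto_nhds_iff

open scoped Matrix.Norms.L2Operator MatrixOrder in
/-- The logarithm of `g g⋆` is self-adjoint and exponentiates to `g g⋆`. -/
theorem exists_log_mul_star (g : GL (Fin N) ℂ) :
    IsSelfAdjoint (CFC.log ((g : Matrix (Fin N) (Fin N) ℂ) * star (g : Matrix (Fin N) (Fin N) ℂ))) ∧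
      NormedSpace.exp (CFC.log ((g : Matrix (Fin N) (Fin N) ℂ) *
        star (g : Matrix (Fin N) (Fin N) ℂ))) =
        (g : Matrix (Fin N) (Fin N) ℂ) * star (g : Matrix (Fin N) (Fin N) ℂ) :=
  ⟨IsSelfAdjoint.log, CFC.exp_log _ (isStrictlyPositive_mul_star g.isUnit)⟩

open scoped Matrix.Norms.L2Operator MatrixOrder in
/-- The limit direction `Y` of `exists_tendsto_exp_mul_exp` lies in `i 𝔨`, for `X` in `i 𝔨`. -/
theorem neg_I_smul_mem_lieK_of_tendsto (G : ComplexReductiveGroup N)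
    {X Y : Matrix (Fin N) (Fin N) ℂ} (hX : X.IsHermitian) (hY : Y.IsHermitian)
    (hXG : ∀ t : ℝ, expGL ((t : ℂ) • X) ∈ G.grp) {g q : GL (Fin N) ℂ} (hg : g ∈ G.grp)
    (hq : Tendsto (fun t : ℝ => NormedSpace.exp ((t : ℂ) • Y) * (g : Matrix (Fin N) (Fin N) ℂ) *
        NormedSpace.exp (((-t : ℝ) : ℂ) • X)) atBot (𝓝 (q : Matrix (Fin N) (Fin N) ℂ))) :
    (-Complex.I) • Y ∈ G.lieK := by
  have h1 : Tendsto (fun n : ℕ => NormedSpace.exp (-(n : ℝ) • Y) * (g : Matrix (Fin N) (Fin N) ℂ) *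
      NormedSpace.exp ((n : ℝ) • X)) atTop (𝓝 (q : Matrix (Fin N) (Fin N) ℂ)) := by
    have := hq.comp (tendsto_neg_atTop_atBot.comp tendsto_natCast_atTop_atTop)
    refine this.congr fun n => ?_
    simp only [Function.comp_apply, Complex.coe_smul, neg_neg]
  have h2 := tendsto_log_conj_exp hX hY g q h1
  have h3 := h2.const_smul (-Complex.I)
  have hclosed : IsClosed (G.lieK : Set (Matrix (Fin N) (Fin N) ℂ)) :=
    Submodule.closed_of_finiteDimensional _
  refine hclosed.mem_of_tendsto h3 (Eventually.of_forall fun n => ?_)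
  rw [smul_comm]
  refine G.lieK.smul_mem _ ?_
  -- With b = g exp(nX) ∈ G, the matrix under the logarithm is b b⋆, which lies in G because G is
  -- stable under conjugate transpose.
  have hb : (g * expGL ((n : ℝ) • X) : GL (Fin N) ℂ) ∈ G.grp :=
    G.grp.mul_mem hg (by rw [← Complex.coe_smul]; exact hXG n)
  have e : ((g * expGL ((n : ℝ) • X) : GL (Fin N) ℂ) : Matrix (Fin N) (Fin N) ℂ) *
      star ((g * expGL ((n : ℝ) • X) : GL (Fin N) ℂ) : Matrix (Fin N) (Fin N) ℂ) =
      (g : Matrix (Fin N) (Fin N) ℂ) * NormedSpace.exp ((2 * (n : ℝ)) • X) *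
        star (g : Matrix (Fin N) (Fin N) ℂ) := by
    rw [two_mul, add_smul, Matrix.exp_add_of_commute _ _ (Commute.refl _), Units.val_mul, star_mul,
      coe_expGL, Matrix.star_eq_conjTranspose (NormedSpace.exp _), ← Matrix.exp_conjTranspose,
      Matrix.conjTranspose_smul, hX.eq, star_trivial]
    simp only [mul_assoc]
  obtain ⟨s1, s2⟩ := exists_log_mul_star (g * expGL ((n : ℝ) • X))
  rw [e] at s1 s2
  refine G.neg_I_smul_mem_lieK s1 ?_
  have : expGL (CFC.log ((g : Matrix (Fin N) (Fin N) ℂ) * NormedSpace.exp ((2 * (n : ℝ)) • X) *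
        star (g : Matrix (Fin N) (Fin N) ℂ))) =
      (g * expGL ((n : ℝ) • X)) * star (g * expGL ((n : ℝ) • X)) :=
    Units.ext (s2.trans e.symm)
  rw [this]
  exact G.grp.mul_mem hb (G.star_mem _ hb)

-- Shifting t by s does not change the limit, so q intertwines exp(sX) and exp(sY) for all real s.
-- Differentiate at s = 0.
open scoped Matrix.Norms.L2Operator in
theorem mul_eq_mul_of_tendsto {X Y : Matrix (Fin N) (Fin N) ℂ} {g q : GL (Fin N) ℂ}
    (hq : Tendsto (fun t : ℝ => NormedSpace.exp ((t : ℂ) • Y) * (g : Matrix (Fin N) (Fin N) ℂ) *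
        NormedSpace.exp (((-t : ℝ) : ℂ) • X)) atBot (𝓝 (q : Matrix (Fin N) (Fin N) ℂ))) :
    Y * (q : Matrix (Fin N) (Fin N) ℂ) = (q : Matrix (Fin N) (Fin N) ℂ) * X := by
  have hs : ∀ s : ℝ, NormedSpace.exp (s • Y) * (q : Matrix (Fin N) (Fin N) ℂ) =
      (q : Matrix (Fin N) (Fin N) ℂ) * NormedSpace.exp (s • X) := by
    intro s
    have h1 := tendsto_const_nhds (x := NormedSpace.exp (s • Y)) |>.mul hq
    have h2 := (hq.comp (tendsto_atBot_add_const_left atBot s tendsto_id)).mul_const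
      (NormedSpace.exp (s • X))
    refine tendsto_nhds_unique h1 (h2.congr fun t => ?_)
    simp only [Function.comp_apply, id, Complex.coe_smul, neg_add, add_smul]
    rw [Matrix.exp_add_of_commute (s • Y) (t • Y) (((Commute.refl Y).smul_left s).smul_right t),
      Matrix.exp_add_of_commute (-s • X) (-t • X)
        (((Commute.refl X).smul_left (-s)).smul_right (-t)), mul_assoc, mul_assoc (_ * _),
      mul_assoc (NormedSpace.exp (-s • X))]
    have e : NormedSpace.exp (-s • X) * (NormedSpace.exp (-t • X) * NormedSpace.exp (s • X)) =
        NormedSpace.exp (-t • X) := by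
      rw [← Matrix.exp_add_of_commute _ _ (((Commute.refl X).smul_left (-t)).smul_right s),
        ← Matrix.exp_add_of_commute, ← add_smul, ← add_smul]
      · simp
      · rw [← add_smul]
        exact ((Commute.refl X).smul_left _).smul_right _
    rw [e]
    simp only [mul_assoc]
  have d1 := (hasDerivAt_exp_smul_const (𝕂 := ℝ) Y (0 : ℝ)).mul_const
    (q : Matrix (Fin N) (Fin N) ℂ)
  have d2 := (hasDerivAt_exp_smul_const (𝕂 := ℝ) X (0 : ℝ)).const_mul
    (q : Matrix (Fin N) (Fin N) ℂ)
  simp only [hs] at d1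
  simpa using d1.unique d2

open scoped Matrix.Norms.L2Operator MatrixOrder in
/-- If `q ∈ G` conjugates a Hermitian matrix `X` to a Hermitian matrix, then `q = k p` with `k ∈ K`
and `p ∈ G` commuting with `X`. -/
theorem exists_polar_commute (G : ComplexReductiveGroup N) {X Y : Matrix (Fin N) (Fin N) ℂ}
    (hX : X.IsHermitian) (hY : Y.IsHermitian) {q : GL (Fin N) ℂ} (hq : q ∈ G.grp)
    (h : Y * (q : Matrix (Fin N) (Fin N) ℂ) = (q : Matrix (Fin N) (Fin N) ℂ) * X) :
    ∃ k ∈ G.compactForm, ∃ p ∈ G.grp, q = k * p ∧ Commute (p : Matrix (Fin N) (Fin N) ℂ) X := by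
  have hsq : star q ∈ G.grp := G.star_mem q hq
  obtain ⟨s1, s2⟩ := exists_log_mul_star (star q)
  rw [Units.coe_star, star_star] at s1 s2
  set Q : Matrix (Fin N) (Fin N) ℂ := q.1
  set H := CFC.log (star Q * Q) with hH
  have h' : X * star Q = star Q * Y := by
    have := congrArg star h
    rw [star_mul, star_mul, Matrix.star_eq_conjTranspose X, hX.eq, Matrix.star_eq_conjTranspose Y,
      hY.eq] at this
    exact this.symm
  have hcomm : Commute (star Q * Q) X := by
    rw [Commute, SemiconjBy, mul_assoc, ← h, ← mul_assoc, ← h', mul_assoc]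
  have hHX : Commute H X := by
    refine Commute.cfc_real ?_ _
    exact hcomm
  have hHG : expGL H ∈ G.grp := by
    have : expGL H = star q * q := Units.ext s2
    rw [this]
    exact G.grp.mul_mem hsq hq
  have hp : ∀ c : ℂ, Commute (expGL (c • H) : Matrix (Fin N) (Fin N) ℂ) X := fun c =>
    (hHX.smul_left c).exp_left
  -- With exp H = q⋆q, the polar decomposition is p = exp(H/2) and k = q exp(-H/2). Here q⋆q
  -- commutes with X because q intertwines two Hermitian matrices, hence so do H and p.
  refine ⟨q * expGL ((-(1 / 2) : ℂ) • H), ⟨G.grp.mul_mem hq (G.expGL_smul_mem s1 hHG _), ?_⟩,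
    expGL ((1 / 2 : ℂ) • H), G.expGL_smul_mem s1 hHG _, ?_, hp _⟩
  · rw [Matrix.mem_unitaryGroup_iff', Units.val_mul, star_mul, coe_expGL,
      Matrix.star_eq_conjTranspose (NormedSpace.exp _), ← Matrix.exp_conjTranspose,
      Matrix.conjTranspose_smul, s1.isHermitian.eq, mul_assoc, ← mul_assoc (star _), ← s2]
    have e : star (-(1 / 2) : ℂ) = -(1 / 2) := by simp
    rw [e, ← Matrix.exp_add_of_commute _ _ ((Commute.refl H).smul_right _),
      ← Matrix.exp_add_of_commute]
    · have : (-(1 / 2) : ℂ) • H + (H + (-(1 / 2) : ℂ) • H) = 0 := by module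
      rw [this, NormedSpace.exp_zero]
    · exact ((Commute.refl H).add_right ((Commute.refl H).smul_right _)).smul_left _
  · rw [mul_assoc, ← expGL_add_of_commute (((Commute.refl H).smul_left _).smul_right _),
      ← add_smul]
    simp

/-- `G = K P(ξ)`: every `g ∈ G` has the form `k b` with `k ∈ K` and `exp (i t ξ) b exp (- i t ξ)`
convergent as `t → -∞`, to an element of `G` commuting with `ξ`. -/
theorem exists_parabolic_decomposition (G : ComplexReductiveGroup N) (ξ : G.lieK) (g : G.grp) :
    ∃ k : G.compactForm, ∃ p : G.grp,
      Commute ((p : GL (Fin N) ℂ) : Matrix (Fin N) (Fin N) ℂ) (ξ : Matrix (Fin N) (Fin N) ℂ) ∧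
      Tendsto (fun t : ℝ => G.exp (Complex.I * t) ξ * ((G.ofK k)⁻¹ * g) *
        G.exp (-(Complex.I * t)) ξ) atBot (𝓝 p) := by
  set X : Matrix (Fin N) (Fin N) ℂ := Complex.I • (ξ : Matrix (Fin N) (Fin N) ℂ) with hXdef
  have hX : X.IsHermitian := by
    rw [Matrix.IsHermitian, ← Matrix.star_eq_conjTranspose, hXdef, star_smul, star_lieK]
    simp
  have hXG : ∀ t : ℝ, expGL ((t : ℂ) • X) ∈ G.grp := by
    intro t
    rw [hXdef, smul_smul]
    exact G.exp_mem_grp _ ξ.2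
  obtain ⟨Y, hY, q, hq⟩ := exists_tendsto_exp_mul_exp hX (g : GL (Fin N) ℂ)
  have hη := neg_I_smul_mem_lieK_of_tendsto G hX hY hXG g.2 hq
  have hYG : ∀ t : ℝ, expGL ((t : ℂ) • Y) ∈ G.grp := by
    intro t
    have := G.exp_mem_grp (t * Complex.I) hη
    rw [smul_smul, mul_assoc] at this
    simpa using this
  have hqG : q ∈ G.grp := G.mem_of_tendsto
    (f := fun t : ℝ => expGL ((t : ℂ) • Y) * g * expGL (((-t : ℝ) : ℂ) • X)) hq fun t =>
      G.grp.mul_mem (G.grp.mul_mem (hYG t) g.2) (hXG _)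
  have hYq := mul_eq_mul_of_tendsto hq
  obtain ⟨k, hk, p, hp, rfl, hpX⟩ := exists_polar_commute G hX hY hqG hYq
  -- As p commutes with X, already k conjugates X to Y. So k⁻¹ exp(tY) g exp(-tX) = exp(tX) k⁻¹g
  -- exp(-tX), with limit k⁻¹q = p.
  have hkY : Y * (k : Matrix (Fin N) (Fin N) ℂ) = k * X := by
    have h1 : Y * k * p = k * X * (p : Matrix (Fin N) (Fin N) ℂ) := by
      rw [mul_assoc, mul_assoc, ← hpX.eq, ← mul_assoc (k : Matrix (Fin N) (Fin N) ℂ)]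
      simpa using hYq
    exact p.isUnit.mul_right_cancel h1
  refine ⟨⟨k, hk⟩, ⟨p, hp⟩, ?_, ?_⟩
  · have := hpX.smul_right (-Complex.I)
    rwa [hXdef, smul_smul, neg_mul, Complex.I_mul_I, neg_neg, one_smul] at this
  · rw [tendsto_subtype_rng, tendsto_GL_iff]
    have h1 := (tendsto_const_nhds (x := ((k⁻¹ : GL (Fin N) ℂ) : Matrix (Fin N) (Fin N) ℂ))
      (f := atBot)).mul hq
    rw [← Units.val_mul, inv_mul_cancel_left] at h1
    refine h1.congr fun t => ?_
    have hXk : X = ((k⁻¹ : GL (Fin N) ℂ) : Matrix (Fin N) (Fin N) ℂ) * Y * k := by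
      rw [mul_assoc, hkY, ← mul_assoc, ← Units.val_mul, inv_mul_cancel, Units.val_one, one_mul]
    have h2 : NormedSpace.exp ((t : ℂ) • X) = ((k⁻¹ : GL (Fin N) ℂ) : Matrix (Fin N) (Fin N) ℂ) *
        NormedSpace.exp ((t : ℂ) • Y) * k := by
      have := Matrix.exp_units_conj k⁻¹ ((t : ℂ) • Y)
      rw [inv_inv] at this
      rw [← this, hXk, Matrix.mul_smul, Matrix.smul_mul]
    change _ = NormedSpace.exp ((Complex.I * t) • (ξ : Matrix (Fin N) (Fin N) ℂ)) *
      (((k⁻¹ : GL (Fin N) ℂ) : Matrix (Fin N) (Fin N) ℂ) * ((g : GL (Fin N) ℂ) : Matrix _ _ ℂ)) *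
      NormedSpace.exp ((-(Complex.I * t)) • (ξ : Matrix (Fin N) (Fin N) ℂ))
    have e1 : (Complex.I * t) • (ξ : Matrix (Fin N) (Fin N) ℂ) = (t : ℂ) • X := by
      rw [hXdef, smul_smul, mul_comm]
    have e2 : (-(Complex.I * t)) • (ξ : Matrix (Fin N) (Fin N) ℂ) = ((-t : ℝ) : ℂ) • X := by
      rw [hXdef, smul_smul, mul_comm, Complex.ofReal_neg, neg_mul]
    rw [e1, e2, h2]
    simp only [mul_assoc, Units.mul_inv_cancel_left]

end Parabolic

/-! ### Exponentials in G and the inner product on 𝔨 -/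

namespace ComplexReductiveGroup

variable {N : ℕ} (G : ComplexReductiveGroup N)

theorem exp_add (z w : ℂ) (ξ : G.lieK) : G.exp (z + w) ξ = G.exp z ξ * G.exp w ξ := by
  refine Subtype.ext ?_
  change expGL _ = expGL _ * expGL _
  rw [add_smul, expGL_add_of_commute (((Commute.refl _).smul_left _).smul_right _)]

@[simp] theorem exp_zero (ξ : G.lieK) : G.exp 0 ξ = 1 := by
  refine Subtype.ext ?_
  change expGL _ = 1
  rw [zero_smul, expGL_zero]

theorem exp_nsmul (n : ℕ) (z : ℂ) (ξ : G.lieK) : G.exp (n * z) ξ = G.exp z ξ ^ n := by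
  induction n with
  | zero => simp
  | succ n ih => rw [pow_succ, ← ih, ← exp_add]; push_cast; ring_nf

theorem exp_mul_comm (z : ℂ) (ξ : G.lieK) {q : G.grp}
    (hq : Commute ((q : GL (Fin N) ℂ) : Matrix (Fin N) (Fin N) ℂ) (ξ : Matrix (Fin N) (Fin N) ℂ)) :
    G.exp z ξ * q = q * G.exp z ξ :=
  Subtype.ext (commute_expGL (hq.smul_right z))

theorem exp_smul_sub_smul (z : ℂ) (s r : ℝ) {ξ η : G.lieK}
    (h : Commute (ξ : Matrix (Fin N) (Fin N) ℂ) (η : Matrix (Fin N) (Fin N) ℂ)) :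
    G.exp z (s • ξ - r • η) = G.exp (s * z) ξ * G.exp (-(r * z)) η := by
  refine Subtype.ext ?_
  change expGL (z • (s • (ξ : Matrix (Fin N) (Fin N) ℂ) - r • (η : Matrix (Fin N) (Fin N) ℂ))) =
    expGL _ * expGL _
  rw [← expGL_add_of_commute ((h.smul_left _).smul_right _), ← Complex.coe_smul s,
    ← Complex.coe_smul r]
  congr 1
  module

namespace InvariantInner

variable {G}
variable (B : G.InvariantInner)

theorem normSq_nonneg (ξ : G.lieK) : 0 ≤ B.normSq ξ := by
  rcases eq_or_ne ξ 0 with rfl | h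
  · simp [normSq]
  · exact (B.pos ξ h).le

theorem form_sq_le (ξ η : G.lieK) : B.form ξ η ^ 2 ≤ B.normSq ξ * B.normSq η := by
  have := B.form.apply_mul_apply_le_of_forall_zero_le B.normSq_nonneg ξ η
  rwa [B.symm η ξ, ← sq] at this

theorem normSq_smul_sub_smul (s r : ℝ) (ξ η : G.lieK) :
    B.normSq (s • ξ - r • η) =
      s ^ 2 * B.normSq ξ - 2 * s * r * B.form ξ η + r ^ 2 * B.normSq η := by
  simp only [normSq, map_sub, map_smul, LinearMap.sub_apply, LinearMap.smul_apply, smul_eq_mul,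
    B.symm η ξ]
  ring

end InvariantInner

end ComplexReductiveGroup

/-! ### Fibre coordinates and holomorphic orbits -/

section Bundle

set_option linter.unusedSectionVars false

variable {E : Type*} [NormedAddCommGroup E] [NormedSpace ℂ E]
variable {X : Type*} [TopologicalSpace X] [ChartedSpace E X]
variable (L : X → Type*) [TopologicalSpace (TotalSpace ℂ L)] [∀ x, TopologicalSpace (L x)]
  [∀ x, AddCommGroup (L x)] [∀ x, Module ℂ (L x)] [FiberBundle ℂ L] [VectorBundle ℂ ℂ L]

theorem fibreCoord_smul (x : X) (c : ℂ) (v : L x) :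
    fibreCoord L x ⟨x, c • v⟩ = c * fibreCoord L x ⟨x, v⟩ :=
  ((trivializationAt ℂ L x).linear ℂ (FiberBundle.mem_baseSet_trivializationAt' x)).map_smul c v

theorem fibreCoord_frame (x : X) : fibreCoord L x ⟨x, frame L x x⟩ = 1 := by
  rw [fibreCoord, frame, Trivialization.apply_mk_symm _
    (FiberBundle.mem_baseSet_trivializationAt' x)]

theorem fibreCoord_smul_frame (x : X) (v : L x) :
    fibreCoord L x ⟨x, v⟩ • frame L x x = v := by
  have hx : x ∈ (trivializationAt ℂ L x).baseSet := FiberBundle.mem_baseSet_trivializationAt' x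
  have h1 := (trivializationAt ℂ L x).symm_apply_apply_mk hx v
  have h2 := ((trivializationAt ℂ L x).symmₗ ℂ x).map_smul (fibreCoord L x ⟨x, v⟩) 1
  rw [smul_eq_mul, mul_one, Trivialization.symmₗ_apply _ hx, Trivialization.symmₗ_apply _ hx] at h2
  exact h2.symm.trans h1

variable {L} {N : ℕ} {G : ComplexReductiveGroup N}
  [MulAction G.grp X] [MulAction G.grp (TotalSpace ℂ L)]

namespace IsLinearisedAction

variable (hact : IsLinearisedAction (E := E) L G)
include hact

theorem exists_smul_mk {g : G.grp} {x y : X} (hg : g • x = y) (v : L x) :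
    ∃ w : L y, g • (⟨x, v⟩ : TotalSpace ℂ L) = ⟨y, w⟩ := by
  have h := (hact.proj_smul g ⟨x, v⟩).trans hg
  generalize g • (⟨x, v⟩ : TotalSpace ℂ L) = p at h
  obtain ⟨y, w⟩ := p
  subst h
  exact ⟨w, rfl⟩

theorem smul_mk_smul {g : G.grp} {x y : X} {v : L x} {w : L y}
    (h : g • (⟨x, v⟩ : TotalSpace ℂ L) = ⟨y, w⟩) (c : ℂ) :
    g • (⟨x, c • v⟩ : TotalSpace ℂ L) = ⟨y, c • w⟩ := by
  rw [hact.linear, h]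

/-- Group elements that fix `x` act on the fibre over `x` by scalars. -/
theorem exists_scalar {g : G.grp} {x : X} (hg : g • x = x) :
    ∃ c : ℂ, ∀ v : L x, g • (⟨x, v⟩ : TotalSpace ℂ L) = ⟨x, c • v⟩ := by
  obtain ⟨w, hw⟩ := hact.exists_smul_mk hg (frame L x x)
  refine ⟨fibreCoord L x ⟨x, w⟩, fun v => ?_⟩
  have := hact.smul_mk_smul hw (fibreCoord L x ⟨x, v⟩)
  rw [fibreCoord_smul_frame] at this
  rw [this]
  congr 1
  conv_lhs => rw [← fibreCoord_smul_frame L x w]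
  conv_rhs => rw [← fibreCoord_smul_frame L x v]
  exact smul_comm _ _ _

theorem contMDiff_orbit (ξ : G.lieK) (p : X) :
    ContMDiff 𝓘(ℂ, ℂ) 𝓘(ℂ, E) ω fun z : ℂ => G.exp z ξ • p :=
  (hact.holomorphic_exp_base ξ).comp (contMDiff_id.prodMk contMDiff_const)

theorem analyticAt_chart_orbit [CompleteSpace E] (ξ : G.lieK) (p : X) :
    AnalyticAt ℂ (fun z : ℂ => chartAt E p (G.exp z ξ • p)) 0 := by
  have h := (hact.contMDiff_orbit ξ p).contMDiffAt (x := 0)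
  rw [contMDiffAt_iff] at h
  have h2 := h.2
  simp only [mfld_simps, contDiffWithinAt_univ, G.exp_zero, one_smul] at h2
  exact h2.analyticAt

theorem eventually_mem_chart_source (ξ : G.lieK) (p : X) :
    ∀ᶠ z : ℂ in 𝓝 0, G.exp z ξ • p ∈ (chartAt E p).source := by
  have hc : ContinuousAt (fun z : ℂ => G.exp z ξ • p) 0 :=
    (hact.contMDiff_orbit ξ p).continuous.continuousAt
  refine hc.eventually_mem ?_
  rw [G.exp_zero, one_smul]
  exact chart_source_mem_nhds E p

/-- A point fixed by `exp (z ξ)` for a set of `z` accumulating at `0` is fixed for all `z`. -/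
theorem exp_smul_eq_of_frequently [CompleteSpace E] {ξ : G.lieK} {p : X}
    (h : ∃ᶠ z in 𝓝[≠] (0 : ℂ), G.exp z ξ • p = p) (z : ℂ) : G.exp z ξ • p = p := by
  have h1 : ∀ᶠ z in 𝓝 (0 : ℂ), chartAt E p (G.exp z ξ • p) = chartAt E p p :=
    ((hact.analyticAt_chart_orbit ξ p).frequently_eq_iff_eventually_eq analyticAt_const).1
      (h.mono fun z hz => by rw [hz])
  have h2 : ∀ᶠ z in 𝓝 (0 : ℂ), G.exp z ξ • p = p := by
    filter_upwards [h1, hact.eventually_mem_chart_source ξ p] with z hz hz'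
    exact (chartAt E p).injOn hz' (mem_chart_source E p) hz
  have h3 : Tendsto (fun n : ℕ => z * (1 / ((n : ℂ) + 1))) atTop (𝓝 0) := by
    simpa using (tendsto_one_div_add_atTop_nhds_zero_nat (𝕜 := ℂ)).const_mul z
  -- The identity theorem gives fixedness only near 0. Any z is an integer multiple of such a small
  -- parameter, and the stabiliser is a group.
  obtain ⟨n, hn⟩ := (h3.eventually h2).exists
  have e : z = ((n + 1 : ℕ) : ℂ) * (z * (1 / ((n : ℂ) + 1))) := by
    have : (n : ℂ) + 1 ≠ 0 := by exact_mod_cast n.succ_ne_zero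
    push_cast
    field_simp
  rw [e, G.exp_nsmul]
  exact MulAction.mem_stabilizer_iff.1
    ((MulAction.stabilizer G.grp p).pow_mem (MulAction.mem_stabilizer_iff.2 hn) _)

/-- Holomorphy in z lets one real line determine the whole complex one-parameter group. It serves w
= 1 (from T fixing x) and w = i (for limits of imaginary flows). -/
theorem exp_smul_eq_of_line [CompleteSpace E] {ξ : G.lieK} {p : X} {w : ℂ} (hw : w ≠ 0)
    (h : ∀ t : ℝ, G.exp (w * t) ξ • p = p) (z : ℂ) : G.exp z ξ • p = p := by
  refine hact.exp_smul_eq_of_frequently ?_ z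
  have hlim : Tendsto (fun n : ℕ => w * (((1 / ((n : ℝ) + 1)) : ℝ) : ℂ)) atTop (𝓝[≠] 0) := by
    refine tendsto_nhdsWithin_iff.2 ⟨?_, Eventually.of_forall fun n => ?_⟩
    · have := ((Complex.continuous_ofReal.tendsto 0).comp
        (tendsto_one_div_add_atTop_nhds_zero_nat (𝕜 := ℝ))).const_mul w
      simpa using this
    · have : (1 / ((n : ℝ) + 1)) ≠ 0 := by positivity
      exact mul_ne_zero hw (Complex.ofReal_ne_zero.2 this)
  exact hlim.frequently (Frequently.of_forall fun n => h _)

/-- `infinitesimal` is a real derivative; the orbit map is holomorphic, so it is also the complex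
one. Hence the imaginary flow has velocity iσ(ξ). -/
theorem hasDerivAt_chart_orbit [CompleteSpace E] (ξ : G.lieK) (p : X) :
    HasDerivAt (fun z : ℂ => chartAt E p (G.exp z ξ • p)) (infinitesimal G ξ p) 0 := by
  have h := (hact.analyticAt_chart_orbit ξ p).differentiableAt.hasDerivAt
  have h' : HasDerivAt (fun t : ℝ => chartAt E p (G.exp t ξ • p))
      (deriv (fun z : ℂ => chartAt E p (G.exp z ξ • p)) 0) 0 := by
    have hof : HasDerivAt (fun t : ℝ => (t : ℂ)) 1 0 := Complex.ofRealCLM.hasDerivAt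
    have h0 : HasDerivAt (fun z : ℂ => chartAt E p (G.exp z ξ • p))
        (deriv (fun z : ℂ => chartAt E p (G.exp z ξ • p)) 0) ((0 : ℝ) : ℂ) := by
      rwa [Complex.ofReal_zero]
    simpa [Function.comp_def] using h0.scomp (0 : ℝ) hof
  rw [infinitesimal, h'.deriv]
  exact h

theorem hasDerivAt_chart_imaginary_orbit [CompleteSpace E] (ξ : G.lieK) (p : X) :
    HasDerivAt (fun t : ℝ => chartAt E p (G.exp (Complex.I * t) ξ • p))
      (Complex.I • infinitesimal G ξ p) 0 := by
  have hof : HasDerivAt (fun t : ℝ => Complex.I * (t : ℂ)) Complex.I 0 := by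
    simpa using Complex.ofRealCLM.hasDerivAt.const_mul Complex.I (x := 0)
  have h0 : HasDerivAt (fun z : ℂ => chartAt E p (G.exp z ξ • p))
      (infinitesimal G ξ p) (Complex.I * ((0 : ℝ) : ℂ)) := by
    rw [Complex.ofReal_zero, mul_zero]
    exact hact.hasDerivAt_chart_orbit ξ p
  exact h0.scomp (0 : ℝ) hof

/-! ### The moment map along imaginary flows and at fixed points -/

variable {h : HermitianMetric (E := E) L} {μ : X → Module.Dual ℝ G.lieK}

/-- `⟨μ, ξ⟩` has nonnegative derivative along the flow of `i ξ`. -/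
theorem exists_hasDerivAt_moment_zero [CompleteSpace E] (hpos : h.IsPositive)
    (hμ : IsMomentMap G h μ) (ξ : G.lieK) (p : X) :
    ∃ c : ℝ, 0 ≤ c ∧ HasDerivAt (fun t : ℝ => μ (G.exp (Complex.I * t) ξ • p) ξ) c 0 := by
  set v : E := infinitesimal G ξ p
  refine ⟨h.kahlerForm p v (Complex.I • v : E), ?_, ?_⟩
  · rcases eq_or_ne v 0 with h0 | h0
    · simp [h0, HermitianMetric.kahlerForm, HermitianMetric.ddPotential]
    · exact (hpos p v h0).le
  · have hm := ((hμ.smooth ξ).mdifferentiableAt (x := p) (by simp)).hasMFDerivAt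
    have hm2 := hm.2
    simp only [mfld_simps] at hm2
    replace hm2 := hm2.hasFDerivAt univ_mem
    rw [← hμ.hamiltonian ξ p (Complex.I • v : E)]
    have hφ := hact.hasDerivAt_chart_imaginary_orbit ξ p
    have hφ0 : chartAt E p (G.exp (Complex.I * ((0 : ℝ) : ℂ)) ξ • p) = chartAt E p p := by
      simp
    rw [← hφ0] at hm2
    have hd := hm2.comp_hasDerivAt (0 : ℝ) hφ
    refine hd.congr_of_eventuallyEq ?_
    have hc : Tendsto (fun t : ℝ => Complex.I * (t : ℂ)) (𝓝 0) (𝓝 0) := by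
      have : Continuous fun t : ℝ => Complex.I * (t : ℂ) := by fun_prop
      simpa using this.tendsto 0
    filter_upwards [hc.eventually (hact.eventually_mem_chart_source ξ p)] with t ht
    simp [ht]
    rfl

theorem monotone_moment [CompleteSpace E] (hpos : h.IsPositive)
    (hμ : IsMomentMap G h μ) (ξ : G.lieK) (p : X) :
    Monotone fun t : ℝ => μ (G.exp (Complex.I * t) ξ • p) ξ := by
  have key : ∀ s : ℝ, ∃ c : ℝ, 0 ≤ c ∧
      HasDerivAt (fun t : ℝ => μ (G.exp (Complex.I * t) ξ • p) ξ) c s := by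
    intro s
    obtain ⟨c, hc, hd⟩ :=
      hact.exists_hasDerivAt_moment_zero hpos hμ ξ (G.exp (Complex.I * s) ξ • p)
    refine ⟨c, hc, ?_⟩
    -- The flow property moves the derivative at time 0, based at the point reached at time s, to
    -- time s.
    rw [← sub_self s] at hd
    have := hd.comp_sub_const s s
    refine this.congr_of_eventuallyEq (Eventually.of_forall fun t => ?_)
    simp only [smul_smul, ← G.exp_add]
    congr 3
    push_cast
    ring_nf
  choose c hc hd using key
  exact monotone_of_hasDerivAt_nonneg hd hc

theorem moment_le_of_tendsto [CompleteSpace E] (hpos : h.IsPositive)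
    (hμ : IsMomentMap G h μ) {ξ : G.lieK} {p p₀ : X}
    (hp : Tendsto (fun t : ℝ => G.exp (Complex.I * t) ξ • p) atBot (𝓝 p₀)) :
    μ p₀ ξ ≤ μ p ξ := by
  have h1 := ((hμ.smooth ξ).continuous.tendsto p₀).comp hp
  have h2 := (hact.monotone_moment hpos hμ ξ p).le_of_tendsto h1 0
  simpa using h2

/-- Shifting time by s preserves the limit, so the imaginary flow fixes p₀; the complex
one-parameter group then does too. -/
theorem exp_smul_eq_of_tendsto [CompleteSpace E] [T2Space X] {ξ : G.lieK} {p p₀ : X}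
    (hp : Tendsto (fun t : ℝ => G.exp (Complex.I * t) ξ • p) atBot (𝓝 p₀)) (z : ℂ) :
    G.exp z ξ • p₀ = p₀ := by
  refine hact.exp_smul_eq_of_line Complex.I_ne_zero (fun s => ?_) z
  have hc : Continuous fun y : X => G.exp (Complex.I * s) ξ • y :=
    hact.continuous_base.comp (continuous_const.prodMk continuous_id)
  have h1 := (hc.tendsto p₀).comp hp
  have h2 := hp.comp (tendsto_atBot_add_const_left atBot s tendsto_id)
  refine tendsto_nhds_unique h1 (h2.congr fun t => ?_)
  simp only [Function.comp_apply, id, smul_smul, ← G.exp_add]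
  congr 2
  push_cast
  ring

omit hact in
/-- At a fixed point of the flow of `ξ` the induced action on the fibre is given by the moment
map. -/
theorem _root_.KempfNess.IsCompatible.hasDerivAt_of_fixed (hcompat : IsCompatible G h μ)
    {ξ : G.lieK} {p : X} (hp : ∀ t : ℝ, G.exp t ξ • p = p) (v : L p) :
    HasDerivAt (fun t : ℝ => fibreCoord L p (G.exp t ξ • (⟨p, v⟩ : TotalSpace ℂ L)))
      (Complex.I * (μ p ξ : ℂ) * fibreCoord L p ⟨p, v⟩) 0 := by
  have h0 : infinitesimal (E := E) G ξ p = 0 := by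
    simp [infinitesimal, hp]
  have := hcompat ξ ⟨p, v⟩
  dsimp only at this
  rw [h0] at this
  simpa [HermitianMetric.chernForm, HermitianMetric.dPotential] using this

-- The vector field vanishes at p, so its horizontal lift does too. Only the vertical term i⟨μ, ξ⟩t
-- remains, and the weight is ⟨μ, ξ⟩.
omit hact in
theorem _root_.KempfNess.IsCompatible.futaki_eq (hcompat : IsCompatible G h μ)
    {ξ : G.lieK} {p : X} (hp : ∀ t : ℝ, G.exp t ξ • p = p) : futaki L G p ξ = -μ p ξ := by
  have := hcompat.hasDerivAt_of_fixed hp (frame L p p)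
  rw [fibreCoord_frame, mul_one] at this
  rw [futaki, this.deriv]
  simp

/-- The weight `⟨μ, ξ⟩` at a fixed point of the flow of `ξ` is unchanged by elements of `G` that
commute with `ξ`. -/
theorem moment_smul_of_commute (hcompat : IsCompatible G h μ) {ξ : G.lieK} {p : X}
    (hp : ∀ t : ℝ, G.exp t ξ • p = p) {q : G.grp}
    (hq : Commute ((q : GL (Fin N) ℂ) : Matrix (Fin N) (Fin N) ℂ) (ξ : Matrix (Fin N) (Fin N) ℂ)) :
    μ (q • p) ξ = μ p ξ := by
  have hqp : ∀ t : ℝ, G.exp t ξ • q • p = q • p := by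
    intro t
    rw [smul_smul, G.exp_mul_comm _ _ hq, ← smul_smul, hp]
  choose c hc using fun t : ℝ => hact.exists_scalar (hp t)
  set e := frame L p p
  have he : fibreCoord L p ⟨p, e⟩ = 1 := fibreCoord_frame L p
  obtain ⟨w, hw⟩ := hact.exists_smul_mk (rfl : q • p = q • p) e
  -- Since q commutes with exp(tξ) and is linear on fibres, the same scalar c t acts over p and over
  -- qp. Comparing derivatives at 0 equates the weights, provided w ≠ 0.
  have hcw : ∀ t : ℝ, G.exp t ξ • (⟨q • p, w⟩ : TotalSpace ℂ L) = ⟨q • p, c t • w⟩ := by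
    intro t
    rw [← hw, smul_smul, G.exp_mul_comm _ _ hq, ← smul_smul, hc, hact.smul_mk_smul hw]
  have hw0 : fibreCoord L (q • p) ⟨q • p, w⟩ ≠ 0 := by
    intro h0
    have hwz : w = 0 := by
      rw [← fibreCoord_smul_frame L (q • p) w, h0, zero_smul]
    have h1 : q⁻¹ • (⟨q • p, w⟩ : TotalSpace ℂ L) = ⟨p, e⟩ := by rw [← hw, inv_smul_smul]
    have h2 := hact.smul_mk_smul h1 0
    rw [zero_smul, zero_smul, ← hwz, h1] at h2
    have h3 := fibreCoord_smul L p 0 e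
    rw [zero_smul, ← h2, he, zero_mul] at h3
    exact one_ne_zero h3
  have d1 := hcompat.hasDerivAt_of_fixed hp e
  have d2 := hcompat.hasDerivAt_of_fixed hqp w
  simp only [hc, hcw, fibreCoord_smul, he, mul_one] at d1 d2
  have d3 := d1.mul_const (fibreCoord L (q • p) ⟨q • p, w⟩)
  have := mul_left_cancel₀ Complex.I_ne_zero (mul_right_cancel₀ hw0 (d2.unique d3))
  exact_mod_cast this

/-- The moment-weight inequality: if `exp (i t ξ) x → x₀` as `t → -∞`, the weight `⟨μ(x₀), ξ⟩`
bounds `⟨μ, ·⟩` from below on the orbit of `x`, at suitable conjugates of `ξ`. -/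
theorem exists_moment_le [CompleteSpace E] [T2Space X] (hpos : h.IsPositive)
    (hμ : IsMomentMap G h μ) (hcompat : IsCompatible G h μ) {ξ : G.lieK} {x x₀ : X}
    (hx : Tendsto (fun t : ℝ => G.exp (Complex.I * t) ξ • x) atBot (𝓝 x₀)) (g : G.grp) :
    ∃ k : G.compactForm, μ x₀ ξ ≤ μ (g • x) (G.Ad k ξ) := by
  obtain ⟨k, p, hpξ, hp⟩ := exists_parabolic_decomposition G ξ g
  refine ⟨k, ?_⟩
  set b := (G.ofK k)⁻¹ * g
  have hlim : Tendsto (fun t : ℝ => G.exp (Complex.I * t) ξ • b • x) atBot (𝓝 (p • x₀)) := by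
    have h1 := (hact.continuous_base.tendsto (p, x₀)).comp (hp.prodMk_nhds hx)
    refine h1.congr fun t => ?_
    simp only [Function.comp_apply, smul_smul]
    rw [mul_assoc, ← G.exp_add, neg_add_cancel, G.exp_zero, mul_one]
  have h2 := hact.moment_le_of_tendsto hpos hμ hlim
  rw [hact.moment_smul_of_commute hcompat (fun t => hact.exp_smul_eq_of_tendsto hx t) hpξ] at h2
  have h3 := hμ.equivariant k (b • x) ξ
  rw [smul_smul, mul_inv_cancel_left] at h3
  rw [h3]
  exact h2

end IsLinearisedAction

/-- At the maximising s = m/a, both sm + n and s²a + n equal n + m²/a, so one factor cancels. -/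
theorem le_of_forall_quadratic {a n m M : ℝ} (ha : 0 < a) (hn : 0 ≤ n) (hm : 0 < m)
    (h : ∀ s : ℝ, 0 < s → (s * m + n) ^ 2 ≤ (s ^ 2 * a + n) * M) : n + m ^ 2 / a ≤ M := by
  have h1 := h (m / a) (by positivity)
  have e1 : m / a * m + n = n + m ^ 2 / a := by ring
  have e2 : (m / a) ^ 2 * a + n = n + m ^ 2 / a := by field_simp; ring
  rw [e1, e2, sq] at h1
  exact le_of_mul_le_mul_left h1 (by positivity)

end Bundle

end KempfNess

/-! ### Choice of the direction ξ and optimisation -/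

theorem theorem1p3p4 {N : ℕ} (G : KempfNess.ComplexReductiveGroup N)
    {E : Type*} [NormedAddCommGroup E] [NormedSpace ℂ E] [FiniteDimensional ℂ E]
    {X : Type*} [TopologicalSpace X] [ChartedSpace E X] [IsManifold 𝓘(ℂ, E) ω X]
    [CompactSpace X] [T2Space X]
    (L : X → Type*) [TopologicalSpace (Bundle.TotalSpace ℂ L)] [∀ x, TopologicalSpace (L x)]
    [∀ x, AddCommGroup (L x)] [∀ x, Module ℂ (L x)] [FiberBundle ℂ L] [VectorBundle ℂ ℂ L]
    [ContMDiffVectorBundle ω ℂ L 𝓘(ℂ, E)]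
    [MulAction G.grp X] [MulAction G.grp (Bundle.TotalSpace ℂ L)]
    (hact : KempfNess.IsLinearisedAction (E := E) L G)
    (h : KempfNess.HermitianMetric (E := E) L) (hpos : h.IsPositive)
    (hK : KempfNess.PreservesForm G h)
    (μ : X → Module.Dual ℝ G.lieK) (hμ : KempfNess.IsMomentMap G h μ)
    (hcompat : KempfNess.IsCompatible G h μ)
    (B : G.InvariantInner) (x : X)
    (T : Subgroup (GL (Fin N) ℂ)) (hT : G.IsTorus T)
    (hTx : ∀ g : G.grp, (g : GL (Fin N) ℂ) ∈ T → g • x = x)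
    (χ : G.lieK) (hχ : KempfNess.IsExtremalField L G B T x χ)
    (α : G.lieK) (hα : α ∈ G.lieCentralizer T)
    (hα_period : ∃ τ : ℝ, 0 < τ ∧ G.exp τ α = 1)
    (x₀ : X) (hx₀ : Filter.Tendsto (fun t : ℝ => G.exp (Complex.I * t) α • x) Filter.atBot (𝓝 x₀))
    (hneg : KempfNess.modifiedFutaki L G B χ x₀ α < 0) :
    B.normSq χ + KempfNess.modifiedFutaki L G B χ x₀ α ^ 2 / B.normSq α ≤
      ⨅ g : G.grp, B.normSq (B.sharp (μ (g • x))) := by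
  have : CompleteSpace E := FiniteDimensional.complete ℂ E
  refine le_ciInf fun g => ?_
  have hχx : ∀ z : ℂ, G.exp z χ • x = x := hact.exp_smul_eq_of_line one_ne_zero fun t => by
    rw [one_mul]
    refine hTx _ ?_
    have := hχ.mem t
    rwa [← Complex.coe_smul] at this
  have hαχ : Commute (α : Matrix (Fin N) (Fin N) ℂ) (χ : Matrix (Fin N) (Fin N) ℂ) := hα χ hχ.mem
  have hαx₀ := hact.exp_smul_eq_of_tendsto hx₀
  have hμα : μ x₀ α = -KempfNess.futaki L G x₀ α := by
    rw [hcompat.futaki_eq fun t => hαx₀ t, neg_neg]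
  have hμχx : μ x χ = -B.normSq χ := by
    rw [show B.normSq χ = KempfNess.futaki L G x χ from (hχ.dual χ hχ.mem).symm, hcompat.futaki_eq fun t => hχx t, neg_neg]
  -- Each exp(itα) commutes with χ, which fixes x, so ⟨μ, χ⟩ is constant along the flow and passes
  -- to the limit x₀.
  have hμχ : μ x₀ χ = -B.normSq χ := by
    rw [← hμχx]
    have h1 := ((hμ.smooth χ).continuous.tendsto x₀).comp hx₀
    refine tendsto_nhds_unique h1 (tendsto_const_nhds.congr fun t => ?_)
    refine (hact.moment_smul_of_commute hcompat (fun s => hχx s) ?_).symm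
    exact (hαχ.smul_left (Complex.I * (t : ℂ))).exp_left
  set m := KempfNess.modifiedFutaki L G B χ x₀ α with hm
  have hfut : KempfNess.futaki L G x₀ α = m + B.form α χ := by
    rw [hm, KempfNess.modifiedFutaki]; ring
  have hα0 : α ≠ 0 := by
    rintro rfl
    have h1 : m = 0 := by
      have := hμα
      rw [map_zero] at this
      rw [hm, KempfNess.modifiedFutaki, map_zero, LinearMap.zero_apply]
      linarith
    exact hneg.ne h1
  have hA : 0 < B.normSq α := B.pos α hα0
  have hn : 0 ≤ B.normSq χ := B.normSq_nonneg χ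
  set a := B.form α χ with ha
  set n := B.normSq χ with hn'
  -- This r is the coefficient of the projection of α to χ; if χ = 0 then a = 0 and any r works.
  obtain ⟨r, hr⟩ : ∃ r : ℝ, r * n = a := by
    rcases eq_or_ne χ 0 with h0 | h0
    · exact ⟨0, by simp [ha, h0]⟩
    · exact ⟨a / n, div_mul_cancel₀ _ (B.pos χ h0).ne'⟩
  rw [← neg_sq m]
  refine KempfNess.le_of_forall_quadratic hA hn (neg_pos.2 hneg) fun s hs => ?_
  -- Here ξ = s(α - rχ) - χ: a multiple of the part of α orthogonal to χ, minus χ. The summands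
  -- along χ do not move x, and the factor s only rescales time.
  set ξ : G.lieK := s • α - (1 + s * r) • χ with hξ
  have hξx : Filter.Tendsto (fun t : ℝ => G.exp (Complex.I * t) ξ • x) Filter.atBot (𝓝 x₀) := by
    have h1 := hx₀.comp (Filter.tendsto_id.const_mul_atBot hs)
    refine h1.congr fun t => ?_
    rw [hξ, G.exp_smul_sub_smul _ _ _ hαχ, ← smul_smul, hχx]
    simp only [Function.comp_apply, id]
    congr 2
    push_cast
    ring
  obtain ⟨k, hk⟩ := hact.exists_moment_le hpos hμ hcompat hξx g
  have hμξ : μ x₀ ξ = s * -m + n := by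
    rw [hξ, map_sub, map_smul, map_smul, hμα, hμχ, hfut]
    simp only [smul_eq_mul]
    linear_combination s * hr
  -- The dropped term s²r²n is s² times the squared norm of the projection of α to χ.
  have hξn : B.normSq ξ ≤ s ^ 2 * B.normSq α + n := by
    have h2 : 0 ≤ s ^ 2 * r ^ 2 * n := by positivity
    rw [hξ, B.normSq_smul_sub_smul]
    have e3 : s ^ 2 * B.normSq α - 2 * s * (1 + s * r) * a + (1 + s * r) ^ 2 * n =
        s ^ 2 * B.normSq α + n - s ^ 2 * r ^ 2 * n := by
      rw [← hr]; ring
    rw [e3]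
    linarith
  have hAd : B.normSq (G.Ad k ξ) = B.normSq ξ := B.invariant k ξ ξ
  have hM := B.form_sq_le (G.Ad k ξ) (B.sharp (μ (g • x)))
  rw [B.symm, B.form_sharp, hAd] at hM
  rw [hμξ] at hk
  have h0 : 0 ≤ s * -m + n := add_nonneg (mul_nonneg hs.le (neg_nonneg.2 hneg.le)) hn
  calc (s * -m + n) ^ 2 ≤ μ (g • x) (G.Ad k ξ) ^ 2 := by gcongr
    _ ≤ _ := hM
    _ ≤ _ := mul_le_mul_of_nonneg_right hξn (B.normSq_nonneg _)
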